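/- **Theorem (Labeled tropical covers and refined Feynman integrals; tropical mirror symmetry for elliptic curves).** Let $g\ge 2$. *Tropical side.* Let $E=\mathbb R/L\mathbb Z$ ($L>0$) be a tropical elliptic curve with base point $p_0=0$ and $2g-2$ fixed distinct vertices $p_1,\dots,p_{2g-2}\neq p_0$, met in this order when one runs once around $E$ from $p_0$. A tropical Hurwitz cover $\pi:C\to E$ is a surjective map from a compact tropical curve $C$ (a connected finite metric graph with a genus function $g(\cdot)$, which is nonzero only at finitely many points) such that: $\pi$ is affine with nonzero integer slope on edges (the absolute value is the weight $\omega(e)$); $\pi$ is harmonic, i.e. at each $v\in C$ the flags over each of the two directions at $\pi(v)$ have the same total weight $d_v$ (the local degree); the local Riemann–Hurwitz inequality $0\le 2d_v-\sum_{e\ni v}(\omega(e)-1)-(2-2g(v))$ (sum over the flags at $v$) holds at all points of $C$; and for each $j$ it is strict at some point over $p_j$. The degree is the sum of the local degrees over a point of $E$. Let $N^{\mathrm{trop}}_{d,g}$ be the number of isomorphism classes of such covers of degree $d$ whose source has genus $b_1(C)+\sum_v g(v)=g$, each counted with multiplicity $\prod_e\omega(e)/|\mathrm{Aut}(\pi)|$,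 where the product runs over the edges of $C$ for the vertex set consisting of the points of valence $\ne2$ or positive genus. A Feynman graph $\Gamma$ of genus $g$ is a connected $3$-valent graph (parallel edges and loops allowed) with labeled vertices $x_1,\dots,x_{2g-2}$ and labeled edges $q_1,\dots,q_{3g-3}$; $x_{k_1},x_{k_2}$ denote the ends of $q_k$. For a total order $\Omega$ of the vertices and $\underline a\in\mathbb N^{3g-3}$ let $N^{\Gamma}_{\underline a,\Omega}$ be the number of labeled tropical Hurwitz covers of $E$ whose source is a metrization of $\Gamma$ (all genera zero), whose vertices lie over $p_1,\dots,p_{2g-2}$ in the order $\Omega$, and with $\#(\pi^{-1}(p_0)\cap q_k)\cdot\omega(q_k)=a_k$ for all $k$; each is counted with multiplicity $\prod_k\omega(q_k)$. *Integral side.* Let $P(z,q)=-\frac1{4\pi^2}\wp(z)-\frac1{12}E_2(q^2)$, where $q=e^{i\pi\tau}$, $\operatorname{Im}\tau>0$, $\wp$ is the Weierstrass function of the lattice $\mathbb Z+\tau\mathbb Z$, and $E_2(q)=1-24\sum_{d\ge1}\sigma_1(d)q^d$. For $q_k=e^{i\pi\tau_k}$ and real numbers $y_1,\dots,y_{2g-2}$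 which are ordered as $\Omega$ prescribes ($y_i<y_j$ iff $x_i<x_j$) and small, i.e. $|y_i-y_j|<\operatorname{Im}\tau_k$ for all $i,j,k$, put $$I_{\Gamma,\Omega}(q_1,\dots,q_{3g-3})=\int_{z_j\in\gamma_j}\prod_{k=1}^{3g-3}P(z_{k_1}-z_{k_2},q_k)\,dz_1\cdots dz_{2g-2},\qquad \gamma_j(t)=iy_j+t,\ t\in[0,1],$$ and $I_{\Gamma,\Omega}=0$ if $\Gamma$ has a loop (where the integrand is not defined). Write $I_{\Gamma,\Omega}(q)=I_{\Gamma,\Omega}(q,\dots,q)$. Then: 1. (Propagator.) If $0<\operatorname{Im}z<\operatorname{Im}\tau$, $x=e^{i\pi z}$, $q=e^{i\pi\tau}$, then, with absolute convergence, $$P(z,q)=\sum_{w\ge1}w\,x^{2w}+\sum_{a\ge1}\Big(\sum_{w\mid a}w\,(x^{2w}+x^{-2w})\Big)q^{2a}.$$ 2. (Labeled covers and constant terms.) For every Feynman graph $\Gamma$ of genus $g$, every order $\Omega$ and every multidegree $\underline a$, there are finitely many labeled covers as above, and $N^\Gamma_{\underline a,\Omega}$ equals the coefficient of $q_1^{2a_1}\cdots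 q_{3g-3}^{2a_{3g-3}}$ in the constant term in all $x_i$ of the formal product $$\prod_{k=1}^{3g-3}\Big[\sum_{w\ge1}w\Big(\tfrac{x_{k_1}}{x_{k_2}}\Big)^{2w}+\sum_{a\ge1}\Big(\sum_{w\mid a}w\Big(\big(\tfrac{x_{k_1}}{x_{k_2}}\big)^{2w}+\big(\tfrac{x_{k_2}}{x_{k_1}}\big)^{2w}\Big)\Big)q_k^{2a}\Big],$$ where in each factor the ends are named so that $x_{k_1}<x_{k_2}$ in $\Omega$; only finitely many choices of one monomial from each factor contribute to this coefficient. 3. (Refined Feynman integrals.) For every $\Gamma$ and $\Omega$ and all $\tau_k$, $y_j$ as above, the integrand is integrable if $\Gamma$ has no loop, and $$I_{\Gamma,\Omega}(q_1,\dots,q_{3g-3})=\sum_{\underline a\in\mathbb N^{3g-3}}N^\Gamma_{\underline a,\Omega}\;q_1^{2a_1}\cdots q_{3g-3}^{2a_{3g-3}}$$ with absolute convergence; that is, $N^\Gamma_{\underline a,\Omega}$ is the $q_1^{2a_1}\cdots q_{3g-3}^{2a_{3g-3}}$-coefficient of $I_{\Gamma,\Omega}$. 4. (Tropical mirror symmetry.)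 For each $d$ there are finitely many isomorphism classes of tropical Hurwitz covers of degree $d$ with source of genus $g$, and for $q=e^{i\pi\tau}$, $\operatorname{Im}\tau>0$, $$\sum_{d\ge1}N^{\mathrm{trop}}_{d,g}\,q^{2d}=\sum_{\Gamma}\frac1{|\mathrm{Aut}(\Gamma)|}\sum_\Omega I_{\Gamma,\Omega}(q),$$ where $\Gamma$ runs over the isomorphism classes of connected $3$-valent graphs of genus $g$ (with a reference labeling chosen for each), $\Omega$ over all total orders of the vertices, and $\mathrm{Aut}(\Gamma)$ is the group of pairs of permutations of the vertices and of the edges of $\Gamma$ compatible with incidence. -/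

import Mathlib

open scoped UpperHalfPlane

noncomputable section

namespace TropicalMirror

/-! ### Graphs, tropical curves, tropical covers of a circle -/

/-- A multigraph (loops and parallel edges allowed) with vertex set `V` and edge set `E`; the edge
`e` joins `end₁ e` and `end₂ e`. The order of the two ends is only a reference parametrization. -/
@[ext]
structure Multigraph (V E : Type) where
  end₁ : E → V
  end₂ : E → V

namespace Multigraph

variable {V E V' E' : Type}

/-- A flag (half-edge) is a pair of an edge and one of its two ends: `(e, false)` is the half of `e`
at `end₁ e` and `(e, true)` the half at `end₂ e`. A loop has two flags at its vertex. -/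
def flagVertex (G : Multigraph V E) (f : E × Bool) : V :=
  if f.2 then G.end₂ f.1 else G.end₁ f.1

open scoped Classical in
/-- The finite set of flags at `v`. -/
def flagsAt [Fintype E] (G : Multigraph V E) (v : V) : Finset (E × Bool) :=
  Finset.univ.filter fun f => G.flagVertex f = v

/-- The valence of a vertex: the number of flags at it. -/
def valence [Fintype E] (G : Multigraph V E) (v : V) : ℕ := (G.flagsAt v).card

/-- Connectedness: there is a vertex, and any two vertices are joined by a chain of edges. -/
def Connected (G : Multigraph V E) : Prop :=
  Nonempty V ∧ ∀ u v, Relation.EqvGen (fun x y => ∃ e, G.end₁ e = x ∧ G.end₂ e = y) u v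

/-- A pair of bijections of the vertices and of the edges is an isomorphism if it is compatible with
the (unordered) pair of ends of each edge. -/
def IsIso (G : Multigraph V E) (G' : Multigraph V' E') (φ : (V ≃ V') × (E ≃ E')) : Prop :=
  ∀ e, (G'.end₁ (φ.2 e) = φ.1 (G.end₁ e) ∧ G'.end₂ (φ.2 e) = φ.1 (G.end₂ e)) ∨
    (G'.end₁ (φ.2 e) = φ.1 (G.end₂ e) ∧ G'.end₂ (φ.2 e) = φ.1 (G.end₁ e))

/-- The order of the automorphism group of a multigraph. -/
def autCard (G : Multigraph V E) : ℕ :=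
  Nat.card {φ : Equiv.Perm V × Equiv.Perm E // G.IsIso G φ}

end Multigraph

/-- A tropical curve without ends: a connected finite metric graph with a genus function. Its
vertices are the canonical ones, i.e. the points of nonzero genus or of valence different from two;
all other points have genus zero. -/
structure TropicalCurve (V E : Type) [Fintype V] [Fintype E] extends Multigraph V E where
  length : E → ℝ
  length_pos : ∀ e, 0 < length e
  genus : V → ℕ
  connected : toMultigraph.Connected
  canonical : ∀ v, genus v ≠ 0 ∨ toMultigraph.valence v ≠ 2

/-- The genus of a tropical curve: the first Betti number `|E| - |V| + 1` of the connected
underlying graph plus the sum of the genera of its points. -/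
def TropicalCurve.totalGenus {V E : Type} [Fintype V] [Fintype E] (C : TropicalCurve V E) : ℤ :=
  (Fintype.card E : ℤ) - Fintype.card V + 1 + ∑ v, (C.genus v : ℤ)

/-- A tropical elliptic curve with `n` vertices: the circle `ℝ / Lℤ` with base point `p₀ = 0` and
with the vertices `p₁, …, pₙ`, met in this order when one runs once around the circle, starting at
`p₀`. -/
structure TropicalEllipticCurve (n : ℕ) where
  circumference : ℝ
  circumference_pos : 0 < circumference
  point : Fin n → ℝ
  point_strictMono : StrictMono point
  point_pos : ∀ j, 0 < point j
  point_lt : ∀ j, point j < circumference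

namespace TropicalEllipticCurve

/-- The underlying circle. -/
abbrev Circle {n : ℕ} (T : TropicalEllipticCurve n) : Type := AddCircle T.circumference

/-- The `j`-th vertex, as a point of the circle. -/
def vertex {n : ℕ} (T : TropicalEllipticCurve n) (j : Fin n) : T.Circle := (T.point j : T.Circle)

end TropicalEllipticCurve

/-- A tropical cover of a tropical elliptic curve. With the edge `e` parametrized by
`[0, length e]`, from `end₁ e` to `end₂ e`, the map is `t ↦ pos (end₁ e) + slope e * t` on `e`; here
`slope e` is a nonzero integer and its absolute value is the weight of `e`. (Harmonicity at the
interior points of `e`, which have valence two, says precisely that the slope does not change along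
`e`.) The flags at a vertex are sorted according to the two flags of the circle at its image, and
harmonicity says that both give the same local degree. -/
structure TropicalCover {n : ℕ} (T : TropicalEllipticCurve n) (V E : Type)
    [Fintype V] [Fintype E] extends TropicalCurve V E where
  pos : V → T.Circle
  slope : E → ℤ
  slope_ne_zero : ∀ e, slope e ≠ 0
  map_end₂ : ∀ e,
    pos (toMultigraph.end₁ e) + (((slope e : ℝ) * length e : ℝ) : T.Circle) =
      pos (toMultigraph.end₂ e)
  surjective : ∀ x : T.Circle, ∃ e, ∃ t ∈ Set.Icc 0 (length e),
    pos (toMultigraph.end₁ e) + (((slope e : ℝ) * t : ℝ) : T.Circle) = x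
  harmonic : ∀ v,
    ∑ f ∈ toMultigraph.flagsAt v with 0 < (if f.2 then -slope f.1 else slope f.1),
        (slope f.1).natAbs =
      ∑ f ∈ toMultigraph.flagsAt v with (if f.2 then -slope f.1 else slope f.1) < 0,
        (slope f.1).natAbs

namespace TropicalCover

variable {n : ℕ} {T : TropicalEllipticCurve n}
  {V E V' E' V'' E'' : Type} [Fintype V] [Fintype E] [Fintype V'] [Fintype E']
  [Fintype V''] [Fintype E'']

/-- The weight (expansion factor) of an edge. -/
def weight (π : TropicalCover T V E) (e : E) : ℕ := (π.slope e).natAbs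

/-- The value of the cover at the point of `e` with parameter `t`. -/
def edgeMap (π : TropicalCover T V E) (e : E) (t : ℝ) : T.Circle :=
  π.pos (π.end₁ e) + (((π.slope e : ℝ) * t : ℝ) : T.Circle)

/-- The slope of the cover on a flag, in the direction leaving the vertex. -/
def flagSlope (π : TropicalCover T V E) (f : E × Bool) : ℤ :=
  if f.2 then -π.slope f.1 else π.slope f.1

/-- The local degree at a vertex: the sum of the weights of the flags over one of the two flags of
the circle. -/
def localDegree (π : TropicalCover T V E) (v : V) : ℕ :=
  ∑ f ∈ π.flagsAt v with 0 < π.flagSlope f, π.weight f.1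

/-- The right hand side of the local Riemann–Hurwitz condition at `v`; all points of the target
have genus zero. -/
def ramification (π : TropicalCover T V E) (v : V) : ℤ :=
  2 * (π.localDegree v : ℤ) - ∑ f ∈ π.flagsAt v, ((π.weight f.1 : ℤ) - 1) -
    (2 - 2 * (π.genus v : ℤ))

/-- Tropical Hurwitz covers of a tropical elliptic curve: the local Riemann–Hurwitz condition holds
everywhere, and it is a strict inequality at some point over each vertex of the target. (At interior
points of edges it is an equality `2 w - 2 (w - 1) - 2 = 0`.) -/
structure IsHurwitz (π : TropicalCover T V E) : Prop where
  nonneg : ∀ v, 0 ≤ π.ramification v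
  strict : ∀ j, ∃ v, π.pos v = T.vertex j ∧ 0 < π.ramification v

/-- The number of interior points of the edge `e` over the base point `p₀`, times the weight. -/
def edgeDegree (π : TropicalCover T V E) (e : E) : ℕ :=
  {t ∈ Set.Ioo 0 (π.length e) | π.edgeMap e t = 0}.ncard * π.weight e

open scoped Classical in
/-- The degree: the sum of the local degrees of the preimages of the base point. -/
def degree (π : TropicalCover T V E) : ℕ :=
  (∑ v with π.pos v = 0, π.localDegree v) + ∑ e, π.edgeDegree e

/-- Isomorphisms of covers: isometries of the sources which respect the genus and commute with the
maps to the target. -/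
def IsIso (π : TropicalCover T V E) (π' : TropicalCover T V' E') (φ : (V ≃ V') × (E ≃ E')) :
    Prop :=
  (∀ v, π'.pos (φ.1 v) = π.pos v) ∧
  (∀ v, π'.genus (φ.1 v) = π.genus v) ∧
  (∀ e, π'.length (φ.2 e) = π.length e) ∧
  ∀ e, (π'.end₁ (φ.2 e) = φ.1 (π.end₁ e) ∧ π'.end₂ (φ.2 e) = φ.1 (π.end₂ e) ∧
      π'.slope (φ.2 e) = π.slope e) ∨
    (π'.end₁ (φ.2 e) = φ.1 (π.end₂ e) ∧ π'.end₂ (φ.2 e) = φ.1 (π.end₁ e) ∧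
      π'.slope (φ.2 e) = -π.slope e)

/-- The order of the automorphism group of a cover. -/
def autCard (π : TropicalCover T V E) : ℕ :=
  Nat.card {φ : Equiv.Perm V × Equiv.Perm E // π.IsIso π φ}

/-- The multiplicity of a cover. -/
def mult (π : TropicalCover T V E) : ℚ := (∏ e, (π.weight e : ℚ)) / π.autCard

theorem IsIso.refl (π : TropicalCover T V E) : π.IsIso π (Equiv.refl V, Equiv.refl E) :=
  ⟨fun _ => rfl, fun _ => rfl, fun _ => rfl, fun _ => Or.inl ⟨rfl, rfl, rfl⟩⟩

theorem IsIso.symm {π : TropicalCover T V E} {π' : TropicalCover T V' E'}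
    {φ : (V ≃ V') × (E ≃ E')} (h : π.IsIso π' φ) : π'.IsIso π (φ.1.symm, φ.2.symm) := by
  obtain ⟨h1, h2, h3, h4⟩ := h
  refine ⟨fun v => ?_, fun v => ?_, fun e => ?_, fun e => ?_⟩
  · simpa using (h1 (φ.1.symm v)).symm
  · simpa using (h2 (φ.1.symm v)).symm
  · simpa using (h3 (φ.2.symm e)).symm
  · rcases h4 (φ.2.symm e) with ⟨ha, hb, hc⟩ | ⟨ha, hb, hc⟩
    · left
      simp only [Equiv.apply_symm_apply] at ha hb hc
      simp [ha, hb, hc]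
    · right
      simp only [Equiv.apply_symm_apply] at ha hb hc
      simp [ha, hb, hc]

theorem IsIso.trans {π : TropicalCover T V E} {π' : TropicalCover T V' E'}
    {π'' : TropicalCover T V'' E''} {φ : (V ≃ V') × (E ≃ E')} {ψ : (V' ≃ V'') × (E' ≃ E'')}
    (h : π.IsIso π' φ) (k : π'.IsIso π'' ψ) :
    π.IsIso π'' (φ.1.trans ψ.1, φ.2.trans ψ.2) := by
  obtain ⟨h1, h2, h3, h4⟩ := h
  obtain ⟨k1, k2, k3, k4⟩ := k
  refine ⟨fun v => ?_, fun v => ?_, fun e => ?_, fun e => ?_⟩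
  · simp [k1, h1]
  · simp [k2, h2]
  · simp [k3, h3]
  · rcases h4 e with ⟨ha, hb, hc⟩ | ⟨ha, hb, hc⟩ <;>
    rcases k4 (φ.2 e) with ⟨ka, kb, kc⟩ | ⟨ka, kb, kc⟩ <;>
    simp [ha, hb, hc, ka, kb, kc]

theorem IsIso.weight_eq {π : TropicalCover T V E} {π' : TropicalCover T V' E'}
    {φ : (V ≃ V') × (E ≃ E')} (h : π.IsIso π' φ) (e : E) : π'.weight (φ.2 e) = π.weight e := by
  rcases h.2.2.2 e with h | h <;> simp [weight, h.2.2]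

theorem IsIso.mult_eq {π : TropicalCover T V E} {π' : TropicalCover T V' E'}
    {φ : (V ≃ V') × (E ≃ E')} (h : π.IsIso π' φ) : π.mult = π'.mult := by
  have hw : ∏ e, (π.weight e : ℚ) = ∏ e, (π'.weight e : ℚ) :=
    Fintype.prod_equiv φ.2 _ _ fun e => by rw [h.weight_eq]
  have ha : π.autCard = π'.autCard := by
    refine Nat.card_congr
      { toFun := fun p => ⟨_, h.symm.trans (p.2.trans h)⟩
        invFun := fun p => ⟨_, h.trans (p.2.trans h.symm)⟩
        left_inv := fun p => ?_
        right_inv := fun p => ?_ }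
    · apply Subtype.ext
      apply Prod.ext <;> ext x <;> simp
    · apply Subtype.ext
      apply Prod.ext <;> ext x <;> simp
  rw [mult, mult, hw, ha]

end TropicalCover

/-! ### The tropical simple Hurwitz number -/

/-- A tropical Hurwitz cover of degree `d` whose source has genus `g`, with vertices and edges
numbered in some way. -/
structure HurwitzCover {n : ℕ} (T : TropicalEllipticCurve n) (g d : ℕ) where
  numVertices : ℕ
  numEdges : ℕ
  cover : TropicalCover T (Fin numVertices) (Fin numEdges)
  isHurwitz : cover.IsHurwitz
  genus_eq : cover.totalGenus = g
  degree_eq : cover.degree = d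

/-- Isomorphism of covers, as an equivalence relation. -/
def hurwitzSetoid {n : ℕ} (T : TropicalEllipticCurve n) (g d : ℕ) : Setoid (HurwitzCover T g d) where
  r π π' := ∃ φ, π.cover.IsIso π'.cover φ
  iseqv :=
    { refl := fun π => ⟨_, TropicalCover.IsIso.refl π.cover⟩
      symm := fun ⟨_, h⟩ => ⟨_, h.symm⟩
      trans := fun ⟨_, h⟩ ⟨_, k⟩ => ⟨_, h.trans k⟩ }

/-- The set of isomorphism classes of tropical Hurwitz covers of degree `d` and source genus `g`. -/
def HurwitzClass {n : ℕ} (T : TropicalEllipticCurve n) (g d : ℕ) : Type :=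
  Quotient (hurwitzSetoid T g d)

/-- The multiplicity of an isomorphism class. -/
def HurwitzClass.mult {n : ℕ} {T : TropicalEllipticCurve n} {g d : ℕ} (c : HurwitzClass T g d) : ℚ :=
  Quotient.lift (s := hurwitzSetoid T g d) (fun π => π.cover.mult) (fun _ _ ⟨_, h⟩ => h.mult_eq) c

/-- The tropical simple Hurwitz number: the weighted count of the isomorphism classes of tropical
Hurwitz covers of degree `d` and source genus `g`. -/
def tropicalHurwitzNumber {n : ℕ} (T : TropicalEllipticCurve n) (g d : ℕ) : ℚ :=
  ∑ᶠ c : HurwitzClass T g d, c.mult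

/-! ### Feynman graphs and labeled covers -/

/-- A (labeled) Feynman graph of genus `g`: a connected `3`-valent graph with vertices
`x_1, …, x_{2g-2}` and edges `q_1, …, q_{3g-3}`. -/
structure FeynmanGraph (g : ℕ) extends Multigraph (Fin (2 * g - 2)) (Fin (3 * g - 3)) where
  trivalent : ∀ v, toMultigraph.valence v = 3
  connected : toMultigraph.Connected

/-- Isomorphism of Feynman graphs (forgetting the labels), as an equivalence relation. -/
def feynmanSetoid (g : ℕ) : Setoid (FeynmanGraph g) where
  r Γ Γ' := ∃ φ, Γ.IsIso Γ'.toMultigraph φ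
  iseqv :=
    { refl := fun Γ => ⟨(Equiv.refl _, Equiv.refl _), fun _ => Or.inl ⟨rfl, rfl⟩⟩
      symm := by
        rintro Γ Γ' ⟨φ, h⟩
        refine ⟨(φ.1.symm, φ.2.symm), fun e => ?_⟩
        rcases h (φ.2.symm e) with ⟨ha, hb⟩ | ⟨ha, hb⟩ <;>
        · simp only [Equiv.apply_symm_apply] at ha hb
          simp [ha, hb]
      trans := by
        rintro Γ Γ' Γ'' ⟨φ, h⟩ ⟨ψ, k⟩
        refine ⟨(φ.1.trans ψ.1, φ.2.trans ψ.2), fun e => ?_⟩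
        rcases h e with ⟨ha, hb⟩ | ⟨ha, hb⟩ <;>
        rcases k (φ.2 e) with ⟨ka, kb⟩ | ⟨ka, kb⟩ <;>
        simp [ha, hb, ka, kb] }

/-- The (finite) set of `3`-valent connected graphs of genus `g`, up to isomorphism. -/
def FeynmanClass (g : ℕ) : Type := Quotient (feynmanSetoid g)

instance (g : ℕ) : Finite (FeynmanClass g) := by
  have : Finite (FeynmanGraph g) := by
    refine Finite.of_injective (fun Γ : FeynmanGraph g => (Γ.end₁, Γ.end₂)) ?_
    rintro ⟨⟨a, b⟩, h1, h2⟩ ⟨⟨a', b'⟩, h3, h4⟩ h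
    simp only [Prod.mk.injEq] at h
    obtain ⟨rfl, rfl⟩ := h
    rfl
  exact inferInstanceAs (Finite (Quotient (feynmanSetoid g)))

/-- A choice of a reference labeling for each isomorphism class of `3`-valent connected graphs. -/
def FeynmanClass.labeled {g : ℕ} (c : FeynmanClass g) : FeynmanGraph g :=
  Quotient.out (s := feynmanSetoid g) c

/-- A total order `Ω` of the vertices is given by the rank `Ω i` of each vertex `x_i`, so that
`x_i < x_j` if and only if `Ω i < Ω j`. -/
abbrev VertexOrder (g : ℕ) : Type := Equiv.Perm (Fin (2 * g - 2))

/-- The labeled tropical Hurwitz covers whose source is a metrization of `Γ`, with its labels, which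
have the order `Ω` (the vertices over `p₁, p₂, …` are met in the order `Ω`), and whose multidegree is
`a`. Isomorphisms of labeled covers respect the labels, so that distinct elements of this set are
not isomorphic as soon as the source has no loops (and a source with loops admits no cover). -/
def LabeledCover {g : ℕ} (T : TropicalEllipticCurve (2 * g - 2)) (Γ : FeynmanGraph g)
    (Ω : VertexOrder g) (a : Fin (3 * g - 3) → ℕ) : Type :=
  {π : TropicalCover T (Fin (2 * g - 2)) (Fin (3 * g - 3)) //
    π.IsHurwitz ∧ π.toMultigraph = Γ.toMultigraph ∧ (∀ i, π.genus i = 0) ∧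
    (∀ i, π.pos i = T.vertex (Ω i)) ∧ ∀ k, π.edgeDegree k = a k}

/-- The weighted count of labeled tropical Hurwitz covers. A labeled cover has no nontrivial
automorphisms, so its multiplicity is the product of its weights. -/
def labeledCount {g : ℕ} (T : TropicalEllipticCurve (2 * g - 2)) (Γ : FeynmanGraph g)
    (Ω : VertexOrder g) (a : Fin (3 * g - 3) → ℕ) : ℕ :=
  ∑ᶠ π : LabeledCover T Γ Ω a, ∏ k, π.1.weight k

/-! ### The propagator and its expansion -/

/-- The period lattice `ℤ + τ ℤ`. -/
def periodPair (τ : ℍ) : PeriodPair where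
  ω₁ := 1
  ω₂ := τ
  indep := by
    rw [LinearIndependent.pair_iff]
    intro s t h
    have him := congrArg Complex.im h
    have ht : t = 0 := by
      simpa [τ.im_ne_zero] using him
    subst ht
    simpa using h

/-- `q = exp(π i τ)`. -/
def nome (τ : ℍ) : ℂ := Complex.exp (Real.pi * Complex.I * τ)

/-- The Eisenstein series `E₂(q) = 1 - 24 ∑_{d ≥ 1} σ(d) q^d`. -/
def eisensteinE₂ (q : ℂ) : ℂ :=
  1 - 24 * ∑' d : ℕ, (ArithmeticFunction.sigma 1 (d + 1) : ℂ) * q ^ (d + 1)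

/-- The propagator `P(z, q) = -℘(z) / (4 π²) - E₂(q²) / 12`, with `q = exp(π i τ)`. -/
def propagator (z : ℂ) (τ : ℍ) : ℂ :=
  -(1 / (4 * (Real.pi : ℂ) ^ 2) * (periodPair τ).weierstrassP z) -
    1 / 12 * eisensteinE₂ (nome τ ^ 2)

/-- The coefficient of `(x_{k₁} / x_{k₂})^{2m} q^{2a}`, `m ∈ ℤ`, in the expansion
`∑_{w ≥ 1} w (x_{k₁}/x_{k₂})^{2w}
  + ∑_{a ≥ 1} (∑_{w ∣ a} w ((x_{k₁}/x_{k₂})^{2w} + (x_{k₂}/x_{k₁})^{2w})) q^{2a}`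
of the propagator for `x_{k₁} < x_{k₂}`. -/
def propagatorCoeff (a : ℕ) (m : ℤ) : ℕ :=
  if a = 0 then (if 0 < m then m.natAbs else 0)
  else (if m ≠ 0 ∧ m.natAbs ∣ a then m.natAbs else 0)

/-- The smaller end of the edge `k` with respect to `Ω`. -/
def lowerEnd {g : ℕ} (Γ : FeynmanGraph g) (Ω : VertexOrder g) (k : Fin (3 * g - 3)) :
    Fin (2 * g - 2) :=
  if Ω (Γ.end₁ k) < Ω (Γ.end₂ k) then Γ.end₁ k else Γ.end₂ k

/-- The larger end of the edge `k` with respect to `Ω`. -/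
def upperEnd {g : ℕ} (Γ : FeynmanGraph g) (Ω : VertexOrder g) (k : Fin (3 * g - 3)) :
    Fin (2 * g - 2) :=
  if Ω (Γ.end₁ k) < Ω (Γ.end₂ k) then Γ.end₂ k else Γ.end₁ k

/-- The exponent of `x_i` in the monomial `∏_k (x_{k₁} / x_{k₂})^{2 m_k}`, where `x_{k₁} < x_{k₂}`
are the ends of `q_k`. -/
def exponentAt {g : ℕ} (Γ : FeynmanGraph g) (Ω : VertexOrder g) (m : Fin (3 * g - 3) → ℤ)
    (i : Fin (2 * g - 2)) : ℤ :=
  ∑ k, ((if lowerEnd Γ Ω k = i then 2 * m k else 0) - (if upperEnd Γ Ω k = i then 2 * m k else 0))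

/-- The contributions to the coefficient of `∏_k q_k^{2 a_k}` in the constant term (in all `x_i`) of
the expanded product `∏_k P(x_{k₁} / x_{k₂}, q_k)`: the choices of one monomial with nonzero
coefficient out of each factor, such that all `x_i` cancel. -/
def constantTermContributions {g : ℕ} (Γ : FeynmanGraph g) (Ω : VertexOrder g)
    (a : Fin (3 * g - 3) → ℕ) : Set (Fin (3 * g - 3) → ℤ) :=
  {m | (∀ k, propagatorCoeff (a k) (m k) ≠ 0) ∧ ∀ i, exponentAt Γ Ω m i = 0}

/-- The coefficient of `∏_k q_k^{2 a_k}` in the constant term (in all `x_i`) of the expanded product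
`∏_k P(x_{k₁} / x_{k₂}, q_k)`. -/
def constantTermCoeff {g : ℕ} (Γ : FeynmanGraph g) (Ω : VertexOrder g)
    (a : Fin (3 * g - 3) → ℕ) : ℕ :=
  ∑ᶠ m ∈ constantTermContributions Γ Ω a, ∏ k, propagatorCoeff (a k) (m k)

/-! ### Feynman integrals -/

/-- The graph has an edge whose two ends coincide. -/
def HasLoop {g : ℕ} (Γ : FeynmanGraph g) : Prop := ∃ k, Γ.end₁ k = Γ.end₂ k

/-- The integrand `∏_k P(z_{k₁} - z_{k₂}, q_k)` at the point `z_j = i y_j + t_j` of the paths. -/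
def feynmanIntegrand {g : ℕ} (Γ : FeynmanGraph g) (y : Fin (2 * g - 2) → ℝ)
    (τ : Fin (3 * g - 3) → ℍ) (t : Fin (2 * g - 2) → ℝ) : ℂ :=
  ∏ k, propagator
    ((Complex.I * y (Γ.end₁ k) + t (Γ.end₁ k)) - (Complex.I * y (Γ.end₂ k) + t (Γ.end₂ k))) (τ k)

open scoped Classical in
/-- The refined Feynman integral, over the paths `γ_j(t) = i y_j + t`, `t ∈ [0, 1]`, as a function
of `q_k = exp(π i τ_k)`. The propagator has a pole at `z = 0`, so the integrand is not defined if the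
graph has a loop; then the integral is `0` by convention. -/
def feynmanIntegral {g : ℕ} (Γ : FeynmanGraph g) (y : Fin (2 * g - 2) → ℝ)
    (τ : Fin (3 * g - 3) → ℍ) : ℂ :=
  if HasLoop Γ then 0
  else ∫ t in Set.Icc (0 : Fin (2 * g - 2) → ℝ) 1, feynmanIntegrand Γ y τ t

/-- The starting points `i y_j` of the paths are admissible for the order `Ω` and for the parameters
`τ_k`: they are ordered as `Ω` says, and they are small (compared with the `τ_k`). -/
def AdmissibleStart {g : ℕ} (Ω : VertexOrder g) (τ : Fin (3 * g - 3) → ℍ)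
    (y : Fin (2 * g - 2) → ℝ) : Prop :=
  (∀ i j, y i < y j ↔ Ω i < Ω j) ∧ ∀ i j k, |y i - y j| < (τ k).im

end TropicalMirror

end

open scoped UpperHalfPlane

noncomputable section

namespace TropicalMirror

/-! ### The Fourier expansion of the propagator -/

/-! Tropical covers and the monomials of the expanded Feynman integrand are the same combinatorial
objects.

The expansion of the propagator comes from summing `℘` over the lattice row by row. Each row is a
sum of inverse squares over translates by `ℤ`, which the Lipschitz formula turns into `-4π² ∑ w
e^{2πiwu}`. The row through the origin also leaves a constant `1/12` and the other rows a Lambert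
series; the term `E₂(q²)/12` cancels both (`propagator_eq_lambertSeries`, `hasSum_propagator`).

An edge of a cover running from `p_i` to `p_j` lifts to a path from `p_i` to `p_j + N L`, so `s l =
p_j - p_i + N L` for its slope `s` and length `l`. It meets the base point `|N|` times, whence `a =
|N| |s|`. A positive length exists exactly if `s N > 0`, or if `N = 0` and `s` points from the
smaller to the larger end; then `l` is determined. So the edges with contribution `a` are the
nonzero integers of absolute value dividing `a` (positive ones if `a = 0`), which index the
monomials of the propagator, with the weight as coefficient. Harmonicity at `x_i` says that the
exponent of `x_i` vanishes. This gives a bijection (`exponents_bijective`). A flux argument through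
cuts bounds the exponents, hence finiteness.

Integration over the real torus extracts the constant term, because the expansion converges
absolutely and its absolute values do not depend on the real parts (`hasSum_feynmanIntegral`).

For unlabeled covers, harmonicity reduces the Riemann–Hurwitz defect at `v` to `val(v) - 2 + 2
g(v)`. It is at least `1` at every vertex and its total is `2g - 2`, while strictness demands one
vertex over each of `2g - 2` points. Hence sources are trivalent of genus zero, with one vertex over
each `p_j` (`IsHurwitz.shape`). Forgetting labels is then orbit–stabilizer for `Aut(Γ)` acting on
the covers with source `Γ` (`autCard_eq_sum`, `tropicalHurwitzNumber_eq`). -/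

open Complex in
/-- The series `∑_{w ≥ 1} w e^{2πiwu}`. -/
def lambertSeries (u : ℂ) : ℂ := ∑' w : ℕ, ((w : ℂ) + 1) * cexp (2 * Real.pi * I * u) ^ (w + 1)

open Complex in
theorem norm_cexp_two_pi_I_mul_lt_one {u : ℂ} (hu : 0 < u.im) :
    ‖cexp (2 * Real.pi * I * u)‖ < 1 :=
  UpperHalfPlane.norm_exp_two_pi_I_lt_one ⟨u, hu⟩

theorem summable_succ_mul_pow_succ {x : ℂ} (hx : ‖x‖ < 1) :
    Summable fun w : ℕ => ((w : ℂ) + 1) * x ^ (w + 1) := by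
  have h := (summable_pow_mul_geometric_of_norm_lt_one 1 hx)
  have := (summable_nat_add_iff 1).2 h
  simpa using this

open Complex in
theorem hasSum_lambertSeries {u : ℂ} (hu : 0 < u.im) :
    HasSum (fun w : ℕ => ((w : ℂ) + 1) * cexp (2 * Real.pi * I * u) ^ (w + 1))
      (lambertSeries u) :=
  (summable_succ_mul_pow_succ (norm_cexp_two_pi_I_mul_lt_one hu)).hasSum

-- Lipschitz formula of weight two; the constant is `(-2πi)² = -4π²`.
open Complex in
theorem hasSum_one_div_add_int_sq {u : ℂ} (hu : 0 < u.im) :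
    HasSum (fun n : ℤ => 1 / (u + n) ^ 2) (-(4 * (Real.pi : ℂ) ^ 2) * lambertSeries u) := by
  have hs : Summable (fun n : ℤ => 1 / (u + n) ^ 2) := by
    have := EisensteinSeries.linear_right_summable u 1 (k := 2) le_rfl
    simpa using this
  have h := EisensteinSeries.qExpansion_identity (k := 1) le_rfl ⟨u, hu⟩
  have h2 : ∑' n : ℕ, (n : ℂ) ^ 1 * cexp (2 * Real.pi * I * u) ^ n = lambertSeries u := by
    rw [Summable.tsum_eq_zero_add]
    · simp [lambertSeries]
    · exact summable_pow_mul_geometric_of_norm_lt_one 1 (norm_cexp_two_pi_I_mul_lt_one hu)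
  have h3 := hs.hasSum
  rw [UpperHalfPlane.coe_mk] at h
  rw [h2] at h
  rw [show (fun n : ℤ => 1 / (u + n) ^ 2) = fun n : ℤ => 1 / (u + n) ^ (1 + 1) from rfl] at h3 ⊢
  rw [h] at h3
  convert! h3 using 1
  have := I_sq
  simp only [Nat.factorial_one]
  push_cast
  linear_combination (-4 * (Real.pi : ℂ) ^ 2 * lambertSeries u) * this

/-- The term at `n = 0` is `1 / 0 = 0`, so the sum is `2 ζ(2)`. -/
theorem hasSum_one_div_int_sq :
    HasSum (fun n : ℤ => 1 / (n : ℂ) ^ 2) ((Real.pi : ℂ) ^ 2 / 3) := by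
  have h := hasSum_zeta_two
  have h' : HasSum (fun n : ℕ => 1 / (n : ℂ) ^ 2) ((Real.pi : ℂ) ^ 2 / 6) := by
    have := Complex.hasSum_ofReal.2 h
    simpa using this
  have h1 : HasSum (fun n : ℕ => 1 / ((n : ℂ) + 1) ^ 2) ((Real.pi : ℂ) ^ 2 / 6) := by
    have := (hasSum_nat_add_iff' 1).2 h'
    simpa using this
  have := HasSum.of_nat_of_neg_add_one (f := fun n : ℤ => 1 / (n : ℂ) ^ 2)
    (m := (Real.pi : ℂ) ^ 2 / 6) (m' := (Real.pi : ℂ) ^ 2 / 6)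
    (by simpa using h') (by
      convert! h1 using 2 with n
      push_cast
      rw [neg_sq])
  convert! this using 1
  ring

/-- The `n`-th row `∑_m` of the lattice sum defining `℘`, divided by `-4π²`. -/
def weierstrassRow (τ z : ℂ) (n : ℤ) : ℂ :=
  if n = 0 then lambertSeries z + 1 / 12
  else if 0 < n then lambertSeries (n * τ - z) - lambertSeries (n * τ)
  else lambertSeries (-n * τ + z) - lambertSeries (-n * τ)

/-- Each row is two Lipschitz sums. Squares are even, so the sign of the argument can be chosen to
land in the upper half plane: `nτ - z` for `n > 0` (this uses `Im z < Im τ`), `-nτ + z` for `n < 0`.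
For `n = 0` the second sum is `π²/3`, which gives the `1/12`. -/
theorem hasSum_weierstrassRow {τ z : ℂ} (hz : 0 < z.im) (hzτ : z.im < τ.im) (n : ℤ) :
    HasSum (fun m : ℤ => 1 / (z - (m + n * τ)) ^ 2 - 1 / ((m : ℂ) + n * τ) ^ 2)
      (-(4 * (Real.pi : ℂ) ^ 2) * weierstrassRow τ z n) := by
  have hτ : 0 < τ.im := hz.trans hzτ
  unfold weierstrassRow
  split_ifs with h0 h1
  · subst h0
    have ha := (Equiv.neg ℤ).hasSum_iff.2 (hasSum_one_div_add_int_sq hz)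
    convert! ha.sub hasSum_one_div_int_sq using 1
    · funext m
      simp [sub_eq_add_neg]
    · have := Real.pi_pos.ne'
      ring
  · have hn : (1 : ℝ) ≤ n := by exact_mod_cast h1
    have h2 : 0 < ((n : ℂ) * τ - z).im := by
      simp
      nlinarith
    have h3 : 0 < ((n : ℂ) * τ).im := by
      simp
      nlinarith
    convert! (hasSum_one_div_add_int_sq h2).sub (hasSum_one_div_add_int_sq h3) using 1
    · funext m
      rw [← neg_sq (z - _)]
      ring_nf
    · ring
  · have hn : (n : ℝ) ≤ -1 := by
      have : n ≤ -1 := by omega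
      exact_mod_cast this
    have h2 : 0 < (-(n : ℂ) * τ + z).im := by
      simp
      nlinarith
    have h3 : 0 < (-(n : ℂ) * τ).im := by
      simp
      nlinarith
    have ha := (Equiv.neg ℤ).hasSum_iff.2 ((hasSum_one_div_add_int_sq h2))
    have hb := (Equiv.neg ℤ).hasSum_iff.2 ((hasSum_one_div_add_int_sq h3))
    convert! ha.sub hb using 1
    · funext m
      simp only [Function.comp, Equiv.neg_apply]
      rw [← neg_sq ((m : ℂ) + n * τ)]
      push_cast
      ring_nf
    · ring

theorem hasSum_weierstrassRow_int (τ : ℍ) {z : ℂ} (hz : 0 < z.im) (hzτ : z.im < τ.im) :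
    HasSum (weierstrassRow τ z)
      (-(1 / (4 * (Real.pi : ℂ) ^ 2)) * (periodPair τ).weierstrassP z) := by
  have h := (periodPair τ).hasSum_weierstrassP z
  -- The coordinates are swapped so that the inner sum runs over multiples of the period `1`, i.e.
  -- along a row.
  have h1 := ((Equiv.prodComm ℤ ℤ).trans (periodPair τ).latticeEquivProd.symm.toEquiv).hasSum_iff.2 h
  have h2 := h1.prod_fiberwise (g := fun n => -(4 * (Real.pi : ℂ) ^ 2) * weierstrassRow τ z n) (by
    intro n
    convert! hasSum_weierstrassRow hz hzτ n using 2 with m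
    have := (periodPair τ).latticeEquiv_symm_apply (m, n)
    simp only [periodPair, mul_one] at this
    simp only [Function.comp, Equiv.trans_apply, Equiv.prodComm_apply, Prod.swap_prod_mk,
      LinearEquiv.coe_toEquiv]
    simp only [periodPair]
    rw [this])
  have h3 := h2.mul_left (-(1 / (4 * (Real.pi : ℂ) ^ 2)))
  convert! h3 using 1
  have : (Real.pi : ℂ) ≠ 0 := by exact_mod_cast Real.pi_ne_zero
  funext n
  field_simp

theorem hasSum_weierstrassRow_nat (τ : ℍ) {z : ℂ} (hz : 0 < z.im) (hzτ : z.im < τ.im) :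
    HasSum (fun n : ℕ => lambertSeries ((n + 1) * τ - z) + lambertSeries ((n + 1) * τ + z) -
        2 * lambertSeries ((n + 1) * τ))
      (-(1 / (4 * (Real.pi : ℂ) ^ 2) * (periodPair τ).weierstrassP z) - lambertSeries z - 1 / 12) := by
  have h := (hasSum_weierstrassRow_int τ hz hzτ).nat_add_neg
  have h1 := (hasSum_nat_add_iff' 1).2 h
  convert! h1 using 1
  · funext n
    have a1 : ¬ ((n : ℤ) + 1 = 0) := by omega
    have a2 : (0 : ℤ) < (n : ℤ) + 1 := by omega
    have a3 : ¬ (-1 + -(n : ℤ) = 0) := by omega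
    have a4 : ¬ ((n : ℤ) < -1) := by omega
    simp [weierstrassRow, a1, a2, a3]
    ring_nf
    rw [if_neg a4]
    ring
  · simp [weierstrassRow]
    ring

-- With `Q = e^{2πiτ}`, the base of the power is `Q^n e^{2πi(τ+v)}`. Since `n (w + 1) ≥ n`, the
-- double series is dominated by a geometric series in `|Q|` times the series at `τ + v`. Only `Im
-- (τ + v) > 0` is needed, so `v = z`, `v = -z` and `v = 0` are all covered.
open Complex in
theorem hasSum_lambertSeries_nat_add {τ v : ℂ} (hτ : 0 < τ.im) (hv : 0 < (τ + v).im) :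
    HasSum (fun p : ℕ × ℕ => ((p.2 : ℂ) + 1) *
        cexp (2 * Real.pi * I * ((p.1 + 1) * τ + v)) ^ (p.2 + 1))
      (∑' n : ℕ, lambertSeries ((n + 1) * τ + v)) := by
  have hx : ∀ n : ℕ, 0 < (((n : ℂ) + 1) * τ + v).im := by
    intro n
    simp at hv ⊢
    have : (0 : ℝ) ≤ n := n.cast_nonneg
    nlinarith
  have hs : Summable (fun p : ℕ × ℕ => ((p.2 : ℂ) + 1) *
        cexp (2 * Real.pi * I * ((p.1 + 1) * τ + v)) ^ (p.2 + 1)) := by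
    have h1 : Summable fun n : ℕ => ‖cexp (2 * Real.pi * I * τ) ^ n‖ := by
      simp_rw [norm_pow]
      exact summable_geometric_of_lt_one (norm_nonneg _) (norm_cexp_two_pi_I_mul_lt_one hτ)
    have h2 := (summable_succ_mul_pow_succ (norm_cexp_two_pi_I_mul_lt_one hv)).norm
    refine Summable.of_norm_bounded (h1.mul_of_nonneg h2 (fun _ => norm_nonneg _)
      fun _ => norm_nonneg _) ?_
    rintro ⟨n, w⟩
    have e : cexp (2 * Real.pi * I * ((n + 1) * τ + v)) =
        cexp (2 * Real.pi * I * τ) ^ n * cexp (2 * Real.pi * I * (τ + v)) := by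
      rw [← Complex.exp_nat_mul, ← Complex.exp_add]
      ring_nf
    simp only [e, mul_pow, norm_mul, norm_pow]
    have hle : ‖cexp (2 * Real.pi * I * τ)‖ ≤ 1 := (norm_cexp_two_pi_I_mul_lt_one hτ).le
    have : (‖cexp (2 * Real.pi * I * τ)‖ ^ n) ^ (w + 1) ≤ ‖cexp (2 * Real.pi * I * τ)‖ ^ n := by
      apply pow_le_of_le_one (by positivity) _ (by omega)
      exact pow_le_one₀ (norm_nonneg _) hle
    calc _ = (‖cexp (2 * Real.pi * I * τ)‖ ^ n) ^ (w + 1) *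
          (‖(w : ℂ) + 1‖ * ‖cexp (2 * Real.pi * I * (τ + v))‖ ^ (w + 1)) := by ring
      _ ≤ _ := by gcongr
  have h := hs.hasSum
  rwa [hs.tsum_prod' fun n => (hasSum_lambertSeries (hx n)).summable] at h

theorem summable_lambertSeries_nat_add {τ v : ℂ} (hτ : 0 < τ.im) (hv : 0 < (τ + v).im) :
    Summable fun n : ℕ => lambertSeries ((n + 1) * τ + v) := by
  have h := (hasSum_lambertSeries_nat_add hτ hv).summable.prod
  simpa only [lambertSeries] using h

open Complex in
theorem tsum_lambertSeries_eq_tsum_sigma (τ : ℍ) :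
    ∑' n : ℕ, lambertSeries ((n + 1) * τ) =
      ∑' d : ℕ, (ArithmeticFunction.sigma 1 (d + 1) : ℂ) * (nome τ ^ 2) ^ (d + 1) := by
  have hq : nome τ ^ 2 = cexp (2 * Real.pi * I * τ) := by
    rw [nome, ← Complex.exp_nat_mul]
    push_cast
    ring_nf
  have h := tsum_prod_pow_eq_tsum_sigma 1 (norm_cexp_two_pi_I_mul_lt_one τ.im_pos)
  rw [tsum_pnat_eq_tsum_succ (f := fun e : ℕ => (ArithmeticFunction.sigma 1 e : ℂ) *
      cexp (2 * Real.pi * I * τ) ^ e),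
    tsum_pnat_eq_tsum_succ (f := fun d : ℕ => ∑' c : ℕ+, (c : ℂ) ^ 1 *
      cexp (2 * Real.pi * I * τ) ^ (d * (c : ℕ)))] at h
  rw [hq, ← h]
  refine tsum_congr fun n => ?_
  rw [tsum_pnat_eq_tsum_succ (f := fun c : ℕ => (c : ℂ) ^ 1 *
      cexp (2 * Real.pi * I * τ) ^ ((n + 1) * c))]
  refine tsum_congr fun w => ?_
  have : cexp (2 * Real.pi * I * ((n + 1) * τ)) = cexp (2 * Real.pi * I * τ) ^ (n + 1) := by
    rw [← Complex.exp_nat_mul]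
    push_cast
    ring_nf
  rw [this, ← pow_mul]
  push_cast
  ring

/-- The paired rows of `℘` contribute `-2 ∑ lambertSeries ((n+1)τ)` besides the wanted terms; as a
series in `σ₁` this cancels against `E₂`, as do the constants `1/12`. -/
theorem propagator_eq_lambertSeries (τ : ℍ) {z : ℂ} (hz : 0 < z.im) (hzτ : z.im < τ.im) :
    propagator z τ = lambertSeries z + (∑' n : ℕ, lambertSeries ((n + 1) * τ + z) +
      ∑' n : ℕ, lambertSeries ((n + 1) * τ + -z)) := by
  have hτ : 0 < (τ : ℂ).im := τ.im_pos
  have h := hasSum_weierstrassRow_nat τ hz hzτ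
  have h1 := (summable_lambertSeries_nat_add (v := z) hτ (by simp; linarith [τ.im_pos])).hasSum
  have h2 := (summable_lambertSeries_nat_add (v := -z) hτ (by simp; linarith)).hasSum
  have h3 := (summable_lambertSeries_nat_add (v := 0) hτ (by simpa using hτ)).hasSum
  simp only [add_zero] at h3
  have h4 := ((h1.add h2).sub (h3.mul_left 2)).unique (by
    convert! h using 2
    ring_nf)
  rw [tsum_lambertSeries_eq_tsum_sigma] at h4
  rw [propagator, eisensteinE₂]
  linear_combination -h4

theorem hasSum_propagator (τ : ℍ) {z : ℂ} (hz : 0 < z.im) (hzτ : z.im < τ.im) :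
    HasSum (fun p : ℕ × ℤ => (propagatorCoeff p.1 p.2 : ℂ) *
        Complex.exp (Complex.I * Real.pi * z) ^ (2 * p.2) * nome τ ^ (2 * p.1))
      (propagator z τ) := by
  have hτ : 0 < (τ : ℂ).im := τ.im_pos
  -- The three Lambert sums are indexed by monomials: a pair `(n, w)` goes to `a = (n+1)(w+1)` and
  -- `m = ±(w+1)`. Pairs `(a, m)` outside the range have coefficient zero.
  let i : ℕ ⊕ (ℕ × ℕ ⊕ ℕ × ℕ) → ℕ × ℤ := Sum.elim (fun w => (0, w + 1))
    (Sum.elim (fun p => ((p.1 + 1) * (p.2 + 1), p.2 + 1))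
      (fun p => ((p.1 + 1) * (p.2 + 1), -((p.2 : ℤ) + 1))))
  have hi : Function.Injective i := by
    rintro (w | p | p) (w' | p' | p') h <;> simp only [i, Sum.elim_inl, Sum.elim_inr,
      Prod.mk.injEq] at h <;> obtain ⟨ha, hb⟩ := h
    · congr 1; omega
    · exact absurd ha.symm (by positivity)
    · exact absurd ha.symm (by positivity)
    · exact absurd ha (by positivity)
    · have e : p.2 = p'.2 := by omega
      rw [e] at ha
      have := Nat.eq_of_mul_eq_mul_right (by omega) ha
      rw [show p = p' from Prod.ext (by omega) e]
    · omega
    · exact absurd ha (by positivity)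
    · omega
    · have e : p.2 = p'.2 := by omega
      rw [e] at ha
      have := Nat.eq_of_mul_eq_mul_right (by omega) ha
      rw [show p = p' from Prod.ext (by omega) e]
  have hx : ∀ m : ℤ, Complex.exp (Complex.I * Real.pi * z) ^ (2 * m) =
      Complex.exp (2 * Real.pi * Complex.I * z * m) := by
    intro m
    rw [← Complex.exp_int_mul]
    push_cast
    ring_nf
  have hq : ∀ a : ℕ, nome τ ^ (2 * a) = Complex.exp (2 * Real.pi * Complex.I * τ * a) := by
    intro a
    rw [nome, ← Complex.exp_nat_mul]
    push_cast
    ring_nf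
  rw [← hi.hasSum_iff, propagator_eq_lambertSeries τ hz hzτ]
  · refine HasSum.sum ?_ (HasSum.sum ?_ ?_)
    · convert! hasSum_lambertSeries hz using 2 with w
      simp only [i, Function.comp, Sum.elim_inl, hx, hq]
      rw [← Complex.exp_nat_mul, propagatorCoeff, if_pos rfl, if_pos (by omega)]
      have : (((w : ℤ) + 1).natAbs : ℂ) = w + 1 := by
        rw [show ((w : ℤ) + 1).natAbs = w + 1 by omega]
        push_cast; ring
      rw [this]
      push_cast
      simp only [mul_zero, Complex.exp_zero, mul_one]
      ring_nf
    · convert! hasSum_lambertSeries_nat_add (v := z) hτ (by simp; linarith [τ.im_pos]) using 2 with p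
      simp only [i, Function.comp, Sum.elim_inl, Sum.elim_inr, hx, hq]
      have e : ((p.2 : ℤ) + 1).natAbs = p.2 + 1 := by omega
      rw [← Complex.exp_nat_mul, propagatorCoeff, if_neg (by positivity), if_pos
        ⟨by omega, by rw [e]; exact dvd_mul_left _ _⟩, e, mul_assoc, ← Complex.exp_add]
      push_cast
      ring_nf
    · convert! hasSum_lambertSeries_nat_add (v := -z) hτ (by simp; linarith) using 2 with p
      simp only [i, Function.comp, Sum.elim_inr, hx, hq]
      have e : (-((p.2 : ℤ) + 1)).natAbs = p.2 + 1 := by omega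
      rw [← Complex.exp_nat_mul, propagatorCoeff, if_neg (by positivity), if_pos
        ⟨by omega, by rw [e]; exact dvd_mul_left _ _⟩, e, mul_assoc, ← Complex.exp_add]
      push_cast
      ring_nf
  · rintro ⟨a, m⟩ hr
    rw [propagatorCoeff]
    split_ifs with h0 hm hm
    · refine absurd ⟨Sum.inl (m.natAbs - 1), ?_⟩ hr
      simp only [i, Sum.elim_inl, Prod.mk.injEq]
      exact ⟨h0.symm, by omega⟩
    · simp
    · obtain ⟨hm0, c, hc⟩ := hm
      simp only at h0 hc
      have hc0 : c ≠ 0 := by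
        rintro rfl
        exact h0 (by simpa using hc)
      have hm1 : m.natAbs - 1 + 1 = m.natAbs := by omega
      have hc1 : c - 1 + 1 = c := by omega
      rcases lt_or_gt_of_ne hm0 with hneg | hpos
      · refine absurd ⟨Sum.inr (Sum.inr (c - 1, m.natAbs - 1)), ?_⟩ hr
        simp only [i, Sum.elim_inr, Prod.mk.injEq, hm1, hc1]
        exact ⟨by rw [hc, mul_comm], by simp only at hneg; omega⟩
      · refine absurd ⟨Sum.inr (Sum.inl (c - 1, m.natAbs - 1)), ?_⟩ hr
        simp only [i, Sum.elim_inr, Sum.elim_inl, Prod.mk.injEq, hm1, hc1]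
        exact ⟨by rw [hc, mul_comm], by simp only at hpos; omega⟩
    · simp

/-! ### Flag sums and harmonicity -/

namespace Multigraph

variable {V E : Type} [Fintype E]

theorem mem_flagsAt (G : Multigraph V E) (v : V) (f : E × Bool) :
    f ∈ G.flagsAt v ↔ G.flagVertex f = v := by
  simp [flagsAt]

open scoped Classical in
theorem sum_flagsAt {M : Type} [AddCommMonoid M] (G : Multigraph V E) (v : V) (f : E × Bool → M) :
    ∑ x ∈ G.flagsAt v, f x = ∑ e, ((if G.end₁ e = v then f (e, false) else 0) +
      (if G.end₂ e = v then f (e, true) else 0)) := by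
  rw [flagsAt, Finset.sum_filter, Fintype.sum_prod_type]
  refine Finset.sum_congr rfl fun e _ => ?_
  rw [Fintype.sum_bool, add_comm]
  simp [flagVertex]

/-- The slope of a flag, in the direction leaving its vertex, for given slopes of the edges. -/
def outSlope (s : E → ℤ) (f : E × Bool) : ℤ := if f.2 then -s f.1 else s f.1

theorem harmonic_iff_sum_outSlope_eq_zero (G : Multigraph V E) (s : E → ℤ) (v : V) :
    (∑ f ∈ G.flagsAt v with 0 < (if f.2 then -s f.1 else s f.1), (s f.1).natAbs =
      ∑ f ∈ G.flagsAt v with (if f.2 then -s f.1 else s f.1) < 0, (s f.1).natAbs) ↔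
    ∑ f ∈ G.flagsAt v, outSlope s f = 0 := by
  have h : ∑ f ∈ G.flagsAt v, outSlope s f =
      ((∑ f ∈ G.flagsAt v with 0 < (if f.2 then -s f.1 else s f.1), (s f.1).natAbs : ℕ) : ℤ) -
      ((∑ f ∈ G.flagsAt v with (if f.2 then -s f.1 else s f.1) < 0, (s f.1).natAbs : ℕ) : ℤ) := by
    push_cast
    rw [Finset.sum_filter, Finset.sum_filter, ← Finset.sum_sub_distrib]
    refine Finset.sum_congr rfl fun f _ => ?_
    unfold outSlope
    split_ifs <;> grind
  rw [h]
  omega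

/-- The two flags of a loop have opposite slopes and cancel, so the third flag at the vertex would
have slope zero. -/
theorem end₂_ne_of_valence_eq_three {G : Multigraph V E} {s : E → ℤ} (hs : ∀ e, s e ≠ 0) {v : V}
    (h3 : G.valence v = 3) (h : ∑ f ∈ G.flagsAt v, outSlope s f = 0) (e : E) (h1 : G.end₁ e = v) :
    G.end₂ e ≠ v := by
  classical
  intro h2
  have hsub : {(e, false), (e, true)} ⊆ G.flagsAt v := by
    intro f hf
    simp only [Finset.mem_insert, Finset.mem_singleton] at hf
    rcases hf with rfl | rfl <;> simp [mem_flagsAt, flagVertex, h1, h2]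
  have hp : ({(e, false), (e, true)} : Finset (E × Bool)).card = 2 := by
    rw [Finset.card_pair]
    simp
  have hc : (G.flagsAt v \ {(e, false), (e, true)}).card = 1 := by
    rw [Finset.card_sdiff_of_subset hsub, hp]
    rw [valence] at h3
    omega
  obtain ⟨f, hf⟩ := Finset.card_eq_one.1 hc
  rw [← Finset.sum_sdiff hsub, hf, Finset.sum_singleton, Finset.sum_pair (by simp)] at h
  have := hs f.1
  simp only [outSlope] at h
  split_ifs at h <;> simp_all

theorem exists_outSlope_pos {G : Multigraph V E} {s : E → ℤ} (hs : ∀ e, s e ≠ 0) {v : V}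
    (h3 : G.valence v ≠ 0) (h : ∑ f ∈ G.flagsAt v, outSlope s f = 0) :
    ∃ f ∈ G.flagsAt v, 0 < outSlope s f := by
  by_contra! hn
  rw [Finset.sum_eq_zero_iff_of_nonpos hn] at h
  obtain ⟨f, hf⟩ := Finset.card_ne_zero.1 h3
  have h1 := h f hf
  have := hs f.1
  simp only [outSlope] at h1
  split_ifs at h1 <;> simp_all

end Multigraph

open Multigraph

/-! ### Lifting the edges of a cover -/

theorem exists_pos_le {ι : Type} [Finite ι] (f : ι → ℝ) (hf : ∀ i, 0 < f i) :
    ∃ δ > 0, ∀ i, δ ≤ f i := by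
  rcases isEmpty_or_nonempty ι with h | h
  · exact ⟨1, one_pos, fun i => h.elim i⟩
  · obtain ⟨i, hi⟩ := Finite.exists_min f
    exact ⟨f i, hf i, hi⟩

/-- At every vertex some flag leaves in the positive direction. Following such flags gives an
endless walk whose lift to `ℝ` advances by at least a fixed `δ > 0` per edge, so it passes over
every point. -/
theorem surjective_of_harmonic {V E : Type} [Fintype E] {L : ℝ} (hL : 0 < L)
    (G : Multigraph V E) [Nonempty V] (length : E → ℝ) (hl : ∀ e, 0 < length e) (pos : V → AddCircle L)
    (s : E → ℤ) (hs : ∀ e, s e ≠ 0) (hv : ∀ v, G.valence v ≠ 0)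
    (hend : ∀ e, pos (G.end₁ e) + (((s e : ℝ) * length e : ℝ) : AddCircle L) = pos (G.end₂ e))
    (hharm : ∀ v, ∑ f ∈ G.flagsAt v, outSlope s f = 0) (x : AddCircle L) :
    ∃ e, ∃ t ∈ Set.Icc 0 (length e), pos (G.end₁ e) + (((s e : ℝ) * t : ℝ) : AddCircle L) = x := by
  obtain ⟨δ, hδ, hδe⟩ := exists_pos_le (fun e => |(s e : ℝ)| * length e) fun e =>
    mul_pos (abs_pos.2 (by exact_mod_cast hs e)) (hl e)
  have step : ∀ (v : V) (r : ℝ), (r : AddCircle L) = pos v → ∃ D ≥ δ, ∃ v',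
      ((r + D : ℝ) : AddCircle L) = pos v' ∧ ∀ x : ℝ, r ≤ x → x ≤ r + D →
      ∃ e, ∃ t ∈ Set.Icc 0 (length e),
        pos (G.end₁ e) + (((s e : ℝ) * t : ℝ) : AddCircle L) = (x : AddCircle L) := by
    intro v r hr
    obtain ⟨⟨e, b⟩, hf, hpos⟩ := exists_outSlope_pos hs (hv v) (hharm v)
    rw [mem_flagsAt] at hf
    have hle := hl e
    refine ⟨_, hδe e, ?_⟩
    cases b
    · simp only [flagVertex, Bool.false_eq_true, if_false] at hf
      simp only [outSlope, Bool.false_eq_true, if_false] at hpos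
      have hpos' : (0 : ℝ) < s e := by exact_mod_cast hpos
      rw [abs_of_pos hpos']
      refine ⟨G.end₂ e, ?_, fun x hx1 hx2 => ⟨e, (x - r) / s e, ⟨?_, ?_⟩, ?_⟩⟩
      · rw [← hend, hf, AddCircle.coe_add, hr]
      · exact div_nonneg (by linarith) hpos'.le
      · rw [div_le_iff₀ hpos']
        linarith
      · rw [hf, ← hr, ← AddCircle.coe_add]
        congr 1
        field_simp
        ring
    · simp only [flagVertex, if_true] at hf
      simp only [outSlope, if_true] at hpos
      have hpos' : (s e : ℝ) < 0 := by
        have : s e < 0 := by omega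
        exact_mod_cast this
      rw [abs_of_neg hpos']
      have h1 : ((r + -(s e : ℝ) * length e : ℝ) : AddCircle L) = pos (G.end₁ e) := by
        have := hend e
        rw [hf, ← hr] at this
        rw [AddCircle.coe_add, ← this, neg_mul, AddCircle.coe_neg]
        abel
      refine ⟨G.end₁ e, h1, fun x hx1 hx2 => ⟨e, (r + -(s e : ℝ) * length e - x) / -s e,
        ⟨?_, ?_⟩, ?_⟩⟩
      · exact div_nonneg (by linarith) (by linarith)
      · rw [div_le_iff₀ (by linarith)]
        linarith
      · rw [← h1, ← AddCircle.coe_add]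
        congr 1
        have := hpos'.ne
        field_simp
        ring
  have main : ∀ (n : ℕ) (v : V) (r : ℝ), (r : AddCircle L) = pos v → ∀ x : ℝ, r ≤ x →
      x ≤ r + n * δ → ∃ e, ∃ t ∈ Set.Icc 0 (length e),
        pos (G.end₁ e) + (((s e : ℝ) * t : ℝ) : AddCircle L) = (x : AddCircle L) := by
    intro n
    induction n with
    | zero =>
      intro v r hr x hx1 hx2
      obtain ⟨D, hD, v', hv', h⟩ := step v r hr
      exact h x hx1 (by simp at hx2; linarith)
    | succ n ih =>
      intro v r hr x hx1 hx2
      obtain ⟨D, hD, v', hv', h⟩ := step v r hr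
      rcases le_or_gt x (r + D) with hx | hx
      · exact h x hx1 hx
      · exact ih v' _ hv' x hx.le (by push_cast at hx2; linarith)
  obtain ⟨v⟩ := ‹Nonempty V›
  obtain ⟨r, hr⟩ := QuotientAddGroup.mk_surjective (pos v)
  obtain ⟨x, rfl⟩ := QuotientAddGroup.mk_surjective x
  -- Move `x` by periods beyond the start `r` of the walk, then take enough steps to reach it.
  obtain ⟨k, hk⟩ := exists_nat_gt ((r - x) / L)
  obtain ⟨n, hn⟩ := exists_nat_gt ((x + k * L - r) / δ)
  rw [div_lt_iff₀ hL] at hk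
  rw [div_lt_iff₀ hδ] at hn
  have := main n v r hr (x + k * L) (by linarith) (by linarith)
  have e : ((x + k * L : ℝ) : AddCircle L) = (x : AddCircle L) := by
    have h0 : ((k * L : ℝ) : AddCircle L) = 0 := by
      rw [AddCircle.coe_eq_zero_iff]
      exact ⟨k, by simp⟩
    rw [AddCircle.coe_add, h0, add_zero]
  rw [e] at this
  exact this

/-- The number of points over the base point in the interior of an edge which is mapped with slope
`s` onto a path with lift from `p` to `p' + N L`. -/
theorem ncard_edge_fiber {L p p' l : ℝ} (hL : 0 < L) (hp : 0 < p) (hpL : p < L) (hp' : 0 < p')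
    (hpL' : p' < L) (hl : 0 < l) {s N : ℤ} (hs : s ≠ 0) (h : s * l = p' - p + N * L) :
    {t ∈ Set.Ioo 0 l | (p : AddCircle L) + (((s : ℝ) * t : ℝ) : AddCircle L) = 0}.ncard =
      N.natAbs := by
  have hs' : (s : ℝ) ≠ 0 := by exact_mod_cast hs
  -- `F j` is the parameter at which the lift `p + s t` passes `j L`.
  let F : ℤ → ℝ := fun j => (j * L - p) / s
  have hF : Function.Injective F := by
    intro i j hij
    simp only [F] at hij
    rw [div_left_inj' hs', sub_left_inj, mul_left_inj' hL.ne'] at hij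
    exact_mod_cast hij
  have key : ∀ t, (p : AddCircle L) + (((s : ℝ) * t : ℝ) : AddCircle L) = 0 ↔ ∃ j, F j = t := by
    intro t
    rw [← AddCircle.coe_add, AddCircle.coe_eq_zero_iff]
    refine exists_congr fun j => ?_
    simp only [F, zsmul_eq_mul]
    rw [div_eq_iff hs']
    constructor <;> intro h <;> linarith
  have set_eq : {t ∈ Set.Ioo 0 l | (p : AddCircle L) + (((s : ℝ) * t : ℝ) : AddCircle L) = 0} =
      F '' {j | 0 < F j ∧ F j < l} := by
    ext t
    simp only [Set.mem_ofPred_eq, Set.mem_Ioo, key, Set.mem_image]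
    constructor
    · rintro ⟨h, j, rfl⟩
      exact ⟨j, h, rfl⟩
    · rintro ⟨j, h, rfl⟩
      exact ⟨h, j, rfl⟩
  rw [set_eq, Set.ncard_image_of_injective _ hF]
  rcases lt_or_gt_of_ne hs with hneg | hpos
  · have hneg' : (s : ℝ) < 0 := by exact_mod_cast hneg
    -- The lift descends from `p` to `p' + N L` with `p, p'` in `(0, L)`, so it crosses the levels
    -- `0, -1, …, N + 1`.
    have : {j | 0 < F j ∧ F j < l} = (Finset.Icc (N + 1) 0 : Finset ℤ) := by
      ext j
      simp only [F, Set.mem_ofPred_eq, Finset.coe_Icc, Set.mem_Icc]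
      rw [div_lt_iff_of_neg hneg', lt_div_iff_of_neg hneg', zero_mul, mul_comm l, h]
      constructor
      · rintro ⟨h1, h2⟩
        have h1' : (j : ℝ) < 1 := by nlinarith
        have h2' : (N : ℝ) < j := by nlinarith
        have : j < 1 := by exact_mod_cast h1'
        have : N < j := by exact_mod_cast h2'
        omega
      · rintro ⟨h1, h2⟩
        have h1' : (N : ℝ) + 1 ≤ j := by exact_mod_cast h1
        have h2' : (j : ℝ) ≤ 0 := by exact_mod_cast h2
        constructor <;> nlinarith
    rw [this, Set.ncard_coe_finset, Int.card_Icc]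
    have hN : (N : ℝ) < 1 := by nlinarith
    have : N < 1 := by exact_mod_cast hN
    omega
  · have hpos' : (0 : ℝ) < s := by exact_mod_cast hpos
    have : {j | 0 < F j ∧ F j < l} = (Finset.Icc 1 N : Finset ℤ) := by
      ext j
      simp only [F, Set.mem_ofPred_eq, Finset.coe_Icc, Set.mem_Icc]
      rw [div_lt_iff₀ hpos', lt_div_iff₀ hpos', zero_mul, mul_comm l, h]
      constructor
      · rintro ⟨h1, h2⟩
        have h1' : (0 : ℝ) < j := by nlinarith
        have h2' : (j : ℝ) < N + 1 := by nlinarith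
        have : 0 < j := by exact_mod_cast h1'
        have : j < N + 1 := by exact_mod_cast h2'
        omega
      · rintro ⟨h1, h2⟩
        have h1' : (1 : ℝ) ≤ j := by exact_mod_cast h1
        have h2' : (j : ℝ) ≤ N := by exact_mod_cast h2
        constructor <;> nlinarith
    rw [this, Set.ncard_coe_finset, Int.card_Icc]
    -- Positive length excludes negative `N`, so the number of levels `1, …, N` is `|N|`.
    have hN : (-1 : ℝ) < N := by nlinarith
    have : -1 < N := by exact_mod_cast hN
    omega

/-! ### Local degree, ramification and lifts of edges -/

namespace TropicalCover

variable {n : ℕ} {T : TropicalEllipticCurve n} {V E : Type} [Fintype V] [Fintype E]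

theorem ext_of_data {π π' : TropicalCover T V E} (h1 : π.toMultigraph = π'.toMultigraph)
    (h2 : π.length = π'.length) (h3 : π.genus = π'.genus) (h4 : π.pos = π'.pos)
    (h5 : π.slope = π'.slope) : π = π' := by
  obtain ⟨⟨G, l, hl, g, hc, hcan⟩, p, s, _, _, _, _⟩ := π
  obtain ⟨⟨G', l', hl', g', hc', hcan'⟩, p', s', _, _, _, _⟩ := π'
  simp only at h1 h2 h3 h4 h5
  subst h1 h2 h3 h4 h5
  rfl

theorem sum_outSlope_eq_zero (π : TropicalCover T V E) (v : V) :
    ∑ f ∈ π.flagsAt v, outSlope π.slope f = 0 :=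
  (harmonic_iff_sum_outSlope_eq_zero _ _ _).1 (π.harmonic v)

theorem sum_weight_flagsAt (π : TropicalCover T V E) (v : V) :
    ∑ f ∈ π.flagsAt v, π.weight f.1 = 2 * π.localDegree v := by
  have h := π.harmonic v
  have h2 : ∑ f ∈ π.flagsAt v, π.weight f.1 =
      (∑ f ∈ π.flagsAt v with 0 < π.flagSlope f, π.weight f.1) +
      ∑ f ∈ π.flagsAt v with π.flagSlope f < 0, π.weight f.1 := by
    rw [Finset.sum_filter, Finset.sum_filter, ← Finset.sum_add_distrib]
    refine Finset.sum_congr rfl fun f _ => ?_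
    have := π.slope_ne_zero f.1
    unfold flagSlope
    split_ifs <;> omega
  rw [h2, two_mul]
  congr 1
  exact h.symm

/-- The weights at `v` add up to twice the local degree, so they drop out of the Riemann–Hurwitz
expression. -/
theorem ramification_eq (π : TropicalCover T V E) (v : V) :
    π.ramification v = (π.valence v : ℤ) - 2 + 2 * π.genus v := by
  have h := π.sum_weight_flagsAt v
  zify at h
  rw [ramification, Finset.sum_sub_distrib, ← h, Multigraph.valence]
  simp only [Finset.sum_const, nsmul_eq_mul, mul_one]
  ring

/-- The lift of an edge between vertices over `p_i` and `p_j`. -/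
theorem exists_lift (π : TropicalCover T V E) (e : E) {i j : Fin n}
    (hi : π.pos (π.end₁ e) = T.vertex i) (hj : π.pos (π.end₂ e) = T.vertex j) :
    ∃ N : ℤ, π.slope e * π.length e = T.point j - T.point i + N * T.circumference ∧
      π.edgeDegree e = N.natAbs * (π.slope e).natAbs := by
  have h := π.map_end₂ e
  rw [hi, hj, TropicalEllipticCurve.vertex, TropicalEllipticCurve.vertex, ← sub_eq_zero,
    ← AddCircle.coe_add, ← AddCircle.coe_sub, AddCircle.coe_eq_zero_iff] at h
  obtain ⟨N, hN⟩ := h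
  rw [zsmul_eq_mul] at hN
  have hN' : π.slope e * π.length e = T.point j - T.point i + N * T.circumference := by linarith
  refine ⟨N, hN', ?_⟩
  rw [edgeDegree, weight]
  congr 1
  simp only [edgeMap, hi]
  exact ncard_edge_fiber T.circumference_pos (T.point_pos i) (T.point_lt i) (T.point_pos j)
    (T.point_lt j) (π.length_pos e) (π.slope_ne_zero e) hN'

end TropicalCover

/-! ### Labeled covers and constant terms -/

section Labeled

variable {g : ℕ} {T : TropicalEllipticCurve (2 * g - 2)} {Γ : FeynmanGraph g} {Ω : VertexOrder g}
  {a : Fin (3 * g - 3) → ℕ}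

/-- The sign `1` if the reference orientation of the edge goes from the smaller to the larger end,
and `-1` otherwise. -/
def orderSign (Γ : FeynmanGraph g) (Ω : VertexOrder g) (k : Fin (3 * g - 3)) : ℤ :=
  if Ω (Γ.end₁ k) < Ω (Γ.end₂ k) then 1 else -1

theorem orderSign_mul_self (k : Fin (3 * g - 3)) : orderSign Γ Ω k * orderSign Γ Ω k = 1 := by
  unfold orderSign
  split_ifs <;> rfl

theorem orderSign_mul_cancel (k : Fin (3 * g - 3)) (m : ℤ) :
    orderSign Γ Ω k * (orderSign Γ Ω k * m) = m := by
  rw [← mul_assoc, orderSign_mul_self, one_mul]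

theorem natAbs_orderSign_mul (k : Fin (3 * g - 3)) (m : ℤ) :
    (orderSign Γ Ω k * m).natAbs = m.natAbs := by
  unfold orderSign
  split_ifs <;> simp

/-- Exponents are oriented from the smaller to the larger end, slopes by the reference orientation;
`orderSign` converts between them. Balance of the monomial at `x_i` thus becomes harmonicity. -/
theorem exponentAt_eq (m : Fin (3 * g - 3) → ℤ) (i : Fin (2 * g - 2)) :
    exponentAt Γ Ω m i =
      2 * ∑ f ∈ Γ.flagsAt i, outSlope (fun k => orderSign Γ Ω k * m k) f := by
  rw [sum_flagsAt, exponentAt, Finset.mul_sum]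
  refine Finset.sum_congr rfl fun k _ => ?_
  simp only [lowerEnd, upperEnd, orderSign, outSlope, Bool.false_eq_true, if_false, if_true]
  split_ifs <;> simp

theorem valence_ne_zero (Γ : FeynmanGraph g) (v : Fin (2 * g - 2)) : Γ.valence v ≠ 0 := by
  rw [Γ.trivalent v]
  decide

theorem propagatorCoeff_ne_zero_iff {a : ℕ} {m : ℤ} : propagatorCoeff a m ≠ 0 ↔
    (a = 0 ∧ 0 < m) ∨ (a ≠ 0 ∧ m ≠ 0 ∧ m.natAbs ∣ a) := by
  unfold propagatorCoeff
  split_ifs <;> simp_all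
  omega

theorem propagatorCoeff_eq_natAbs {a : ℕ} {m : ℤ} (h : propagatorCoeff a m ≠ 0) :
    propagatorCoeff a m = m.natAbs := by
  unfold propagatorCoeff at h ⊢
  split_ifs at h ⊢ <;> simp_all

theorem ne_zero_of_propagatorCoeff_ne_zero {a : ℕ} {m : ℤ} (h : propagatorCoeff a m ≠ 0) :
    m ≠ 0 := by
  rw [propagatorCoeff_eq_natAbs h] at h
  simpa using h

theorem not_hasLoop_of_mem_constantTermContributions {m : Fin (3 * g - 3) → ℤ}
    (hm : m ∈ constantTermContributions Γ Ω a) : ¬ HasLoop Γ := by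
  rintro ⟨k, hk⟩
  refine end₂_ne_of_valence_eq_three (s := fun k => orderSign Γ Ω k * m k) ?_
    (Γ.trivalent (Γ.end₁ k)) ?_ k rfl hk.symm
  · intro e h
    have := natAbs_orderSign_mul (Γ := Γ) (Ω := Ω) e (m e)
    rw [h] at this
    have := ne_zero_of_propagatorCoeff_ne_zero (hm.1 e)
    omega
  · have := hm.2 (Γ.end₁ k)
    rw [exponentAt_eq] at this
    omega

theorem lowerEnd_le_upperEnd (k : Fin (3 * g - 3)) :
    Ω (lowerEnd Γ Ω k) ≤ Ω (upperEnd Γ Ω k) := by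
  unfold lowerEnd upperEnd
  split_ifs with h
  · exact h.le
  · exact not_lt.1 h

theorem lowerEnd_lt_upperEnd (h : ¬ HasLoop Γ) (k : Fin (3 * g - 3)) :
    Ω (lowerEnd Γ Ω k) < Ω (upperEnd Γ Ω k) := by
  refine lt_of_le_of_ne (lowerEnd_le_upperEnd k) fun h1 => h ⟨k, ?_⟩
  have h2 := Ω.injective h1
  unfold lowerEnd upperEnd at h2
  split_ifs at h2
  · exact h2
  · exact h2.symm

/-- The monomials which contribute to a constant term have no flux through any cut. -/
theorem sum_crossing_eq_zero {m : Fin (3 * g - 3) → ℤ} (hm : ∀ i, exponentAt Γ Ω m i = 0)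
    (j : Fin (2 * g - 2)) :
    ∑ k with Ω (lowerEnd Γ Ω k) ≤ j ∧ j < Ω (upperEnd Γ Ω k), m k = 0 := by
  have h : ∑ i with Ω i ≤ j, exponentAt Γ Ω m i = 0 := Finset.sum_eq_zero fun i _ => hm i
  simp only [exponentAt] at h
  rw [Finset.sum_comm] at h
  -- In the sum over all vertices up to `j`, an edge with both ends on the same side of the cut
  -- contributes zero.
  have h2 : ∀ k, ∑ i with Ω i ≤ j, ((if lowerEnd Γ Ω k = i then 2 * m k else 0) -
      (if upperEnd Γ Ω k = i then 2 * m k else 0)) =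
      2 * if Ω (lowerEnd Γ Ω k) ≤ j ∧ j < Ω (upperEnd Γ Ω k) then m k else 0 := by
    intro k
    rw [Finset.sum_sub_distrib, Finset.sum_ite_eq, Finset.sum_ite_eq]
    have := lowerEnd_le_upperEnd (Γ := Γ) (Ω := Ω) k
    simp only [Finset.mem_filter, Finset.mem_univ, true_and]
    split_ifs <;> grind
  simp only [h2] at h
  rw [← Finset.mul_sum, ← Finset.sum_filter] at h
  omega

/-- If `a_k ≠ 0`, then `m_k` divides `a_k`. If `a_k = 0`, then `m_k > 0`, and the cut just after the
lower end of `k` has no flux: the other crossing edges compensate `m_k`, and each of them satisfies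
`m_l ≥ -a_l`. -/
theorem natAbs_le_of_mem_constantTermContributions {m : Fin (3 * g - 3) → ℤ}
    (hm : m ∈ constantTermContributions Γ Ω a) (k : Fin (3 * g - 3)) :
    (m k).natAbs ≤ ∑ l, a l := by
  have hlow : ∀ l, -(a l : ℤ) ≤ m l := by
    intro l
    rcases propagatorCoeff_ne_zero_iff.1 (hm.1 l) with ⟨h1, h2⟩ | ⟨h1, h2, h3⟩
    · omega
    · have := Nat.le_of_dvd (by omega) h3
      omega
  rcases propagatorCoeff_ne_zero_iff.1 (hm.1 k) with ⟨h1, h2⟩ | ⟨h1, h2, h3⟩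
  · have hlt := lowerEnd_lt_upperEnd (Ω := Ω) (not_hasLoop_of_mem_constantTermContributions hm) k
    have h := sum_crossing_eq_zero hm.2 (Ω (lowerEnd Γ Ω k))
    rw [← Finset.add_sum_erase _ _ (a := k) (by simp [hlt])] at h
    have h4 : ∀ S : Finset (Fin (3 * g - 3)), -(∑ l, a l : ℤ) ≤ ∑ x ∈ S, m x := by
      intro S
      refine le_trans (neg_le_neg (Finset.sum_le_sum_of_subset_of_nonneg (Finset.subset_univ S)
        fun _ _ _ => by simp)) ?_
      rw [← Finset.sum_neg_distrib]
      exact Finset.sum_le_sum fun x _ => hlow x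
    have h5 := h4 (Finset.erase {l | Ω (lowerEnd Γ Ω l) ≤ Ω (lowerEnd Γ Ω k) ∧
      Ω (lowerEnd Γ Ω k) < Ω (upperEnd Γ Ω l)} k)
    zify
    rw [abs_of_pos h2]
    linarith
  · exact (Nat.le_of_dvd (by omega) h3).trans
      (Finset.single_le_sum (f := a) (fun _ _ => Nat.zero_le _) (Finset.mem_univ k))

theorem finite_constantTermContributions : (constantTermContributions Γ Ω a).Finite := by
  refine (Set.finite_Icc (fun _ => -(∑ l, a l : ℤ)) (fun _ => (∑ l, a l : ℤ))).subset ?_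
  intro m hm
  have h := natAbs_le_of_mem_constantTermContributions hm
  constructor <;> intro k <;> have := h k <;> zify at this <;> have := abs_le.1 this <;>
    simp only <;> linarith

/-- The monomial that corresponds to a labeled cover. -/
def LabeledCover.exponents (π : LabeledCover T Γ Ω a) (k : Fin (3 * g - 3)) : ℤ :=
  orderSign Γ Ω k * π.1.slope k

/-! ### The bijection between labeled covers and contributing monomials -/

namespace LabeledCover

theorem exists_lift (π : LabeledCover T Γ Ω a) (k : Fin (3 * g - 3)) :
    ∃ N : ℤ, π.1.slope k * π.1.length k =
      T.point (Ω (Γ.end₂ k)) - T.point (Ω (Γ.end₁ k)) + N * T.circumference ∧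
      a k = N.natAbs * (π.1.slope k).natAbs := by
  obtain ⟨π, h1, h2, h3, h4, h5⟩ := π
  have := π.exists_lift k (h4 (π.end₁ k)) (h4 (π.end₂ k))
  rw [h5] at this
  rwa [h2] at this

/-- If the winding number is zero, positivity of the length forces the slope to point from the
smaller to the larger end; otherwise the weight divides `a k` with quotient `|N| ≠ 0`. These are the
two cases with nonzero coefficient. -/
theorem propagatorCoeff_exponents (π : LabeledCover T Γ Ω a) (k : Fin (3 * g - 3)) :
    propagatorCoeff (a k) (π.exponents k) = π.1.weight k := by
  obtain ⟨N, h1, h2⟩ := π.exists_lift k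
  have hs := π.1.slope_ne_zero k
  have hl := π.1.length_pos k
  have hne : propagatorCoeff (a k) (π.exponents k) ≠ 0 := by
    rw [propagatorCoeff_ne_zero_iff, exponents, natAbs_orderSign_mul, h2]
    by_cases hN : N = 0
    · left
      refine ⟨by simp [hN], ?_⟩
      rw [hN, Int.cast_zero, zero_mul, add_zero] at h1
      unfold orderSign
      split_ifs with h
      · have := T.point_strictMono h
        have h3 : (0 : ℝ) < π.1.slope k := by
          by_contra h4
          nlinarith
        have : 0 < π.1.slope k := by exact_mod_cast h3
        omega
      · have := T.point_strictMono.monotone (not_lt.1 h)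
        have h3 : (π.1.slope k : ℝ) ≤ 0 := by
          by_contra h4
          nlinarith
        have : π.1.slope k ≤ 0 := by exact_mod_cast h3
        omega
    · right
      refine ⟨mul_ne_zero (by omega) (by omega), ?_, dvd_mul_left _ _⟩
      unfold orderSign
      split_ifs <;> omega
  rw [propagatorCoeff_eq_natAbs hne, exponents, natAbs_orderSign_mul, TropicalCover.weight]

theorem exponents_mem (π : LabeledCover T Γ Ω a) :
    π.exponents ∈ constantTermContributions Γ Ω a := by
  constructor
  · intro k
    rw [propagatorCoeff_exponents, TropicalCover.weight, Int.natAbs_ne_zero]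
    exact π.1.slope_ne_zero k
  · intro i
    have := π.1.sum_outSlope_eq_zero i
    rw [π.2.2.1] at this
    rw [exponentAt_eq]
    simp only [exponents, orderSign_mul_cancel]
    rw [this, mul_zero]

theorem point_sub_lt {n : ℕ} (T : TropicalEllipticCurve n) (i j : Fin n) :
    T.point i - T.point j < T.circumference := by
  linarith [T.point_lt i, T.point_pos j]

/-- The winding number of a lift is determined by the slope and the number of points over the base
point. -/
theorem winding_eq {n : ℕ} (T : TropicalEllipticCurve n) {i j : Fin n} {l : ℝ} (hl : 0 < l)
    {s N : ℤ} (hs : s ≠ 0) (h : s * l = T.point j - T.point i + N * T.circumference) :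
    N = s.sign * N.natAbs := by
  have h1 := point_sub_lt T i j
  have h2 := point_sub_lt T j i
  have hL := T.circumference_pos
  rcases lt_or_gt_of_ne hs with hneg | hpos
  · have hneg' : (s : ℝ) < 0 := by exact_mod_cast hneg
    have hN : (N : ℝ) < 1 := by nlinarith
    have : N < 1 := by exact_mod_cast hN
    rw [Int.sign_eq_neg_one_of_neg hneg]
    omega
  · have hpos' : (0 : ℝ) < s := by exact_mod_cast hpos
    have hN : (-1 : ℝ) < N := by nlinarith
    have : -1 < N := by exact_mod_cast hN
    rw [Int.sign_eq_one_of_pos hpos]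
    omega

/-- The exponents give the slopes, `|N| = a / |s|` gives the winding numbers up to sign, and the
sign is that of `s`. The lengths follow. -/
theorem exponents_injective :
    Function.Injective (exponents : LabeledCover T Γ Ω a → Fin (3 * g - 3) → ℤ) := by
  intro π π' h
  have hs : π.1.slope = π'.1.slope := by
    funext k
    have := congrFun h k
    simp only [exponents] at this
    rw [← orderSign_mul_cancel (Γ := Γ) (Ω := Ω) k (π.1.slope k), this, orderSign_mul_cancel]
  apply Subtype.ext
  refine TropicalCover.ext_of_data ?_ ?_ ?_ ?_ hs
  · rw [π.2.2.1, π'.2.2.1]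
  · funext k
    obtain ⟨N, h1, h2⟩ := π.exists_lift k
    obtain ⟨N', h1', h2'⟩ := π'.exists_lift k
    have hs0 := π.1.slope_ne_zero k
    have w := winding_eq T (π.1.length_pos k) (π.1.slope_ne_zero k) h1
    have w' := winding_eq T (π'.1.length_pos k) (π'.1.slope_ne_zero k) h1'
    rw [← hs] at h1' h2' w'
    have hN : N.natAbs = N'.natAbs :=
      Nat.eq_of_mul_eq_mul_right (by omega) (h2.symm.trans h2')
    rw [hN, ← w'] at w
    rw [w, ← h1'] at h1
    exact mul_left_cancel₀ (by exact_mod_cast hs0) h1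
  · funext i
    rw [π.2.2.2.1, π'.2.2.2.1]
  · funext i
    rw [π.2.2.2.2.1, π'.2.2.2.2.1]

/-- If `N ≠ 0`, the summand `N L` outweighs `p_j - p_i`, so the numerator has the sign of `N`. -/
theorem lift_pos {n : ℕ} (T : TropicalEllipticCurve n) {i j : Fin n} {s N : ℤ}
    (h : N = 0 ∧ 0 < (s : ℝ) * (T.point j - T.point i) ∨ 0 < s * N) :
    0 < (T.point j - T.point i + N * T.circumference) / s := by
  have hij := point_sub_lt T i j
  have hji := point_sub_lt T j i
  have hL := T.circumference_pos
  rcases h with ⟨rfl, h⟩ | h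
  · simp only [Int.cast_zero, zero_mul, add_zero]
    have hs : (s : ℝ) ≠ 0 := by
      intro h0
      simp [h0] at h
    rw [div_pos_iff]
    rcases mul_pos_iff.1 h with h | h
    · exact Or.inl ⟨h.2, h.1⟩
    · exact Or.inr ⟨h.2, h.1⟩
  · rw [div_pos_iff]
    rcases mul_pos_iff.1 h with ⟨h1, h2⟩ | ⟨h1, h2⟩
    · have h2' : (1 : ℝ) ≤ N := by exact_mod_cast h2
      exact Or.inl ⟨by nlinarith, by exact_mod_cast h1⟩
    · have h2' : (N : ℝ) ≤ -1 := by
        have : N ≤ -1 := by omega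
        exact_mod_cast this
      exact Or.inr ⟨by nlinarith, by exact_mod_cast h1⟩

theorem exponents_surjective {m : Fin (3 * g - 3) → ℤ} (hm : m ∈ constantTermContributions Γ Ω a) :
    ∃ π : LabeledCover T Γ Ω a, π.exponents = m := by
  have hloop := not_hasLoop_of_mem_constantTermContributions hm
  let s : Fin (3 * g - 3) → ℤ := fun k => orderSign Γ Ω k * m k
  -- The only winding number compatible with the slope and `a k`; it vanishes if `a k = 0`.
  let N : Fin (3 * g - 3) → ℤ := fun k => (s k).sign * ((a k / (m k).natAbs : ℕ) : ℤ)
  have hm0 : ∀ k, m k ≠ 0 := fun k => ne_zero_of_propagatorCoeff_ne_zero (hm.1 k)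
  have hsabs : ∀ k, (s k).natAbs = (m k).natAbs := fun k => natAbs_orderSign_mul k (m k)
  have hs : ∀ k, s k ≠ 0 := fun k => by
    have := hm0 k
    have := hsabs k
    omega
  have hNabs : ∀ k, (N k).natAbs * (s k).natAbs = a k := by
    intro k
    simp only [N]
    rw [Int.natAbs_mul, Int.natAbs_sign_of_ne_zero (hs k), one_mul, hsabs, Int.natAbs_natCast]
    rcases propagatorCoeff_ne_zero_iff.1 (hm.1 k) with ⟨h1, h2⟩ | ⟨h1, h2, h3⟩
    · simp [h1]
    · exact Nat.div_mul_cancel h3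
  have hpos : ∀ k, N k = 0 ∧
      0 < (s k : ℝ) * (T.point (Ω (Γ.end₂ k)) - T.point (Ω (Γ.end₁ k))) ∨ 0 < s k * N k := by
    intro k
    rcases propagatorCoeff_ne_zero_iff.1 (hm.1 k) with ⟨h1, h2⟩ | ⟨h1, h2, h3⟩
    · left
      refine ⟨by simp [N, h1], ?_⟩
      have h2' : (0 : ℝ) < m k := by exact_mod_cast h2
      simp only [s, orderSign]
      split_ifs with h
      · have := T.point_strictMono h
        rw [one_mul]
        nlinarith
      · have : Ω (Γ.end₂ k) < Ω (Γ.end₁ k) :=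
          lt_of_le_of_ne (not_lt.1 h) fun h => hloop ⟨k, (Ω.injective h).symm⟩
        have := T.point_strictMono this
        push_cast
        nlinarith
    · right
      have h4 : 0 < a k / (m k).natAbs :=
        Nat.div_pos (Nat.le_of_dvd (by omega) h3) (by omega)
      simp only [N]
      rw [← mul_assoc, Int.mul_sign_self]
      have := hs k
      exact mul_pos (by omega) (by exact_mod_cast h4)
  have hharm : ∀ v, ∑ f ∈ Γ.flagsAt v, outSlope s f = 0 := by
    intro v
    have := hm.2 v
    rw [exponentAt_eq] at this
    simp only [s]
    omega
  let l : Fin (3 * g - 3) → ℝ := fun k => (T.point (Ω (Γ.end₂ k)) - T.point (Ω (Γ.end₁ k)) +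
    N k * T.circumference) / s k
  have hl : ∀ k, 0 < l k := fun k => lift_pos T (hpos k)
  have hlift : ∀ k, s k * l k = T.point (Ω (Γ.end₂ k)) - T.point (Ω (Γ.end₁ k)) +
      N k * T.circumference := by
    intro k
    have : (s k : ℝ) ≠ 0 := by exact_mod_cast hs k
    simp only [l]
    field_simp
  have hend : ∀ k, T.vertex (Ω (Γ.end₁ k)) + (((s k : ℝ) * l k : ℝ) : T.Circle) =
      T.vertex (Ω (Γ.end₂ k)) := by
    intro k
    rw [hlift, TropicalEllipticCurve.vertex, TropicalEllipticCurve.vertex, ← AddCircle.coe_add,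
      ← sub_eq_zero, ← AddCircle.coe_sub, AddCircle.coe_eq_zero_iff]
    exact ⟨N k, by rw [zsmul_eq_mul]; ring⟩
  have : Nonempty (Fin (2 * g - 2)) := Γ.connected.1
  let π : TropicalCover T (Fin (2 * g - 2)) (Fin (3 * g - 3)) :=
    { toMultigraph := Γ.toMultigraph
      length := l
      length_pos := hl
      genus := fun _ => 0
      connected := Γ.connected
      canonical := fun v => Or.inr (by rw [Γ.trivalent v]; decide)
      pos := fun i => T.vertex (Ω i)
      slope := s
      slope_ne_zero := hs
      map_end₂ := hend
      surjective := surjective_of_harmonic T.circumference_pos Γ.toMultigraph l hl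
        (fun i => T.vertex (Ω i)) s hs
        (valence_ne_zero Γ) hend hharm
      harmonic := fun v => (harmonic_iff_sum_outSlope_eq_zero _ _ _).2 (hharm v) }
  -- Trivalence and genus zero make every vertex strict, so the Hurwitz conditions hold
  -- automatically.
  have hram : ∀ v, π.ramification v = 1 := by
    intro v
    rw [π.ramification_eq]
    have : π.valence v = 3 := Γ.trivalent v
    rw [this]
    rfl
  have hdeg : ∀ k, π.edgeDegree k = a k := by
    intro k
    rw [← hNabs k, TropicalCover.edgeDegree]
    congr 1
    exact ncard_edge_fiber T.circumference_pos (T.point_pos _) (T.point_lt _) (T.point_pos _)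
      (T.point_lt _) (hl k) (hs k) (hlift k)
  refine ⟨⟨π, ⟨fun v => by rw [hram]; decide, fun j => ⟨Ω.symm j, ?_, by rw [hram]; decide⟩⟩, rfl,
    fun _ => rfl, fun _ => rfl, hdeg⟩, ?_⟩
  · simp [π]
  · funext k
    exact orderSign_mul_cancel k (m k)

theorem exponents_bijective : Function.Bijective
    (fun π => ⟨π.exponents, π.exponents_mem⟩ :
      LabeledCover T Γ Ω a → constantTermContributions Γ Ω a) := by
  constructor
  · intro π π' h
    exact exponents_injective (congrArg Subtype.val h)
  · rintro ⟨m, hm⟩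
    obtain ⟨π, hπ⟩ := exponents_surjective (T := T) hm
    exact ⟨π, Subtype.ext hπ⟩

instance : Finite (LabeledCover T Γ Ω a) := by
  have : Finite (constantTermContributions Γ Ω a) := finite_constantTermContributions
  exact Finite.of_injective _ exponents_bijective.1

end LabeledCover

theorem labeledCount_eq_constantTermCoeff :
    labeledCount T Γ Ω a = constantTermCoeff Γ Ω a := by
  rw [labeledCount, constantTermCoeff, ← finsum_set_coe_eq_finsum_mem]
  refine finsum_eq_of_bijective _ LabeledCover.exponents_bijective fun π => ?_
  exact Finset.prod_congr rfl fun k _ => (π.propagatorCoeff_exponents k).symm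

theorem constantTermCoeff_eq_zero_of_hasLoop (h : HasLoop Γ) : constantTermCoeff Γ Ω a = 0 := by
  rw [constantTermCoeff]
  refine finsum_mem_eq_zero_of_forall_eq_zero fun m hm => ?_
  exact absurd h (not_hasLoop_of_mem_constantTermContributions hm)

/-- In degree zero the bound on the exponents makes them all vanish, but some edge exists and its
exponent is nonzero. -/
theorem constantTermCoeff_zero (hg : 2 ≤ g) (ha : ∑ k, a k = 0) : constantTermCoeff Γ Ω a = 0 := by
  rw [constantTermCoeff]
  refine finsum_mem_eq_zero_of_forall_eq_zero fun m hm => ?_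
  let k : Fin (3 * g - 3) := ⟨0, by omega⟩
  have h1 := natAbs_le_of_mem_constantTermContributions hm k
  have h2 := ne_zero_of_propagatorCoeff_ne_zero (hm.1 k)
  omega

end Labeled

/-! ### Refined Feynman integrals -/

/-- In `ℂ` summable families are absolutely summable, so the factors can be multiplied out one at a
time. -/
theorem hasSum_prod_fin {ι : Type} (n : ℕ) (f : Fin n → ι → ℂ) (s : Fin n → ℂ)
    (hf : ∀ k, HasSum (f k) (s k)) :
    HasSum (fun p : Fin n → ι => ∏ k, f k (p k)) (∏ k, s k) := by
  induction n with
  | zero => simp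
  | succ n ih =>
    have h := ih (fun k => f k.succ) (fun k => s k.succ) fun k => hf k.succ
    rw [← (Fin.consEquiv fun _ => ι).hasSum_iff, Fin.prod_univ_succ]
    have hs : Summable fun x : ι × (Fin n → ι) => f 0 x.1 * ∏ k, f (Fin.succ k) (x.2 k) :=
      summable_mul_of_summable_norm (f := f 0) (g := fun p : Fin n → ι => ∏ k, f (Fin.succ k) (p k))
        (hf 0).summable.norm h.summable.norm
    have h2 := (hf 0).mul h hs
    convert! h2 using 2 with p
    simp [Fin.prod_univ_succ]

theorem integral_Icc_cexp_int (y : ℝ) (c : ℤ) :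
    ∫ t in Set.Icc (0 : ℝ) 1, Complex.exp (2 * Real.pi * Complex.I * c * (Complex.I * y + t)) =
      if c = 0 then 1 else 0 := by
  split_ifs with h
  · simp [h]
  · have h1 : ∀ t : ℝ, Complex.exp (2 * Real.pi * Complex.I * c * (Complex.I * y + t)) =
        Complex.exp (2 * Real.pi * Complex.I * c * (Complex.I * y)) *
        Complex.exp (2 * Real.pi * Complex.I * c * t) := by
      intro t
      rw [← Complex.exp_add]
      ring_nf
    simp only [h1]
    rw [MeasureTheory.integral_const_mul, MeasureTheory.integral_Icc_eq_integral_Ioc,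
      ← intervalIntegral.integral_of_le zero_le_one, integral_exp_mul_complex]
    · have : Complex.exp (2 * Real.pi * Complex.I * c * (1 : ℝ)) = 1 := by
        rw [Complex.exp_eq_one_iff]
        exact ⟨c, by push_cast; ring⟩
      rw [this]
      simp
    · simp [h, Real.pi_ne_zero]

theorem integral_cube_cexp {n : ℕ} (y : Fin n → ℝ) (c : Fin n → ℤ) :
    ∫ t in Set.Icc (0 : Fin n → ℝ) 1,
      ∏ i, Complex.exp (2 * Real.pi * Complex.I * c i * (Complex.I * y i + t i)) =
      if ∀ i, c i = 0 then 1 else 0 := by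
  have hc : Set.Icc (0 : Fin n → ℝ) 1 = Set.univ.pi fun _ => Set.Icc (0 : ℝ) 1 := by
    rw [Set.pi_univ_Icc]
    rfl
  rw [hc, MeasureTheory.volume_pi, MeasureTheory.Measure.restrict_pi_pi,
    MeasureTheory.integral_fintype_prod_eq_prod (f := fun i (t : ℝ) =>
      Complex.exp (2 * Real.pi * Complex.I * c i * (Complex.I * y i + t)))]
  simp only [integral_Icc_cexp_int]
  split_ifs with h
  · simp [h]
  · push Not at h
    obtain ⟨i, hi⟩ := h
    exact Finset.prod_eq_zero (Finset.mem_univ i) (by simp [hi])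

theorem propagator_neg (z : ℂ) (τ : ℍ) : propagator (-z) τ = propagator z τ := by
  simp [propagator]

section Integral

variable {g : ℕ} {Γ : FeynmanGraph g} {Ω : VertexOrder g}
  {a : Fin (3 * g - 3) → ℕ} {τ : Fin (3 * g - 3) → ℍ} {y : Fin (2 * g - 2) → ℝ}

/-- The monomial of the expanded integrand which belongs to a choice of a monomial from each
factor. -/
def integrandTerm (Γ : FeynmanGraph g) (Ω : VertexOrder g) (y : Fin (2 * g - 2) → ℝ)
    (τ : Fin (3 * g - 3) → ℍ) (p : Fin (3 * g - 3) → ℕ × ℤ) (t : Fin (2 * g - 2) → ℝ) : ℂ :=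
  ∏ k, ((propagatorCoeff (p k).1 (p k).2 : ℂ) * Complex.exp (2 * Real.pi * Complex.I * (p k).2 *
    ((Complex.I * y (upperEnd Γ Ω k) + t (upperEnd Γ Ω k)) -
      (Complex.I * y (lowerEnd Γ Ω k) + t (lowerEnd Γ Ω k)))) * nome (τ k) ^ (2 * (p k).1))

/-- The propagator is even, so its argument may be taken as upper minus lower end. Its imaginary
part is then positive (there are no loops) and less than `Im τ_k`, where the expansion is valid. -/
theorem hasSum_integrandTerm (hloop : ¬ HasLoop Γ) (hy : AdmissibleStart Ω τ y)
    (t : Fin (2 * g - 2) → ℝ) :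
    HasSum (fun p => integrandTerm Γ Ω y τ p t) (feynmanIntegrand Γ y τ t) := by
  refine hasSum_prod_fin _ (fun k (p : ℕ × ℤ) => (propagatorCoeff p.1 p.2 : ℂ) *
    Complex.exp (2 * Real.pi * Complex.I * p.2 *
    ((Complex.I * y (upperEnd Γ Ω k) + t (upperEnd Γ Ω k)) -
      (Complex.I * y (lowerEnd Γ Ω k) + t (lowerEnd Γ Ω k)))) * nome (τ k) ^ (2 * p.1)) _ fun k => ?_
  set z : ℂ := (Complex.I * y (upperEnd Γ Ω k) + t (upperEnd Γ Ω k)) -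
      (Complex.I * y (lowerEnd Γ Ω k) + t (lowerEnd Γ Ω k)) with hz
  have him : z.im = y (upperEnd Γ Ω k) - y (lowerEnd Γ Ω k) := by
    simp [hz]
  have h1 : 0 < z.im := by
    rw [him, sub_pos, hy.1]
    exact lowerEnd_lt_upperEnd hloop k
  have h2 : z.im < (τ k).im := by
    rw [him]
    exact (le_abs_self _).trans_lt (hy.2 _ _ k)
  have h := hasSum_propagator (τ k) h1 h2
  convert! h using 1
  · funext p
    rw [← Complex.exp_int_mul]
    push_cast
    ring_nf
  · rw [hz]
    unfold upperEnd lowerEnd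
    split_ifs
    · rw [← propagator_neg]
      ring_nf
    · rfl

/-- Real translations only change phases. The values at `t = 0` are therefore a summable majorant,
uniform in `t`, for both continuity and termwise integration. -/
theorem norm_integrandTerm (p : Fin (3 * g - 3) → ℕ × ℤ) (t : Fin (2 * g - 2) → ℝ) :
    ‖integrandTerm Γ Ω y τ p t‖ = ‖integrandTerm Γ Ω y τ p 0‖ := by
  simp only [integrandTerm, norm_prod]
  refine Finset.prod_congr rfl fun k _ => ?_
  rw [norm_mul, norm_mul, norm_mul, norm_mul, Complex.norm_exp, Complex.norm_exp]
  congr 3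
  simp

theorem continuous_integrandTerm (p : Fin (3 * g - 3) → ℕ × ℤ) :
    Continuous (integrandTerm Γ Ω y τ p) := by
  unfold integrandTerm
  fun_prop

theorem continuous_feynmanIntegrand (hloop : ¬ HasLoop Γ) (hy : AdmissibleStart Ω τ y) :
    Continuous (feynmanIntegrand Γ y τ) := by
  have h : feynmanIntegrand Γ y τ = fun t => ∑' p, integrandTerm Γ Ω y τ p t := by
    funext t
    exact (hasSum_integrandTerm hloop hy t).tsum_eq.symm
  rw [h]
  exact continuous_tsum continuous_integrandTerm (hasSum_integrandTerm hloop hy 0).summable.norm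
    fun p t => (norm_integrandTerm p t).le

theorem integrableOn_feynmanIntegrand (hloop : ¬ HasLoop Γ) (hy : AdmissibleStart Ω τ y) :
    MeasureTheory.IntegrableOn (feynmanIntegrand Γ y τ) (Set.Icc 0 1) :=
  (continuous_feynmanIntegrand hloop hy).continuousOn.integrableOn_compact isCompact_Icc

/-- Regrouping the exponentials from edges to vertices separates the variables, so that the integral
factors. -/
theorem integrandTerm_eq (p : Fin (3 * g - 3) → ℕ × ℤ) (t : Fin (2 * g - 2) → ℝ) :
    integrandTerm Γ Ω y τ p t = (∏ k, ((propagatorCoeff (p k).1 (p k).2 : ℂ) *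
      nome (τ k) ^ (2 * (p k).1))) * ∏ i, Complex.exp (2 * Real.pi * Complex.I *
        (∑ k, ((if upperEnd Γ Ω k = i then (p k).2 else 0) -
          (if lowerEnd Γ Ω k = i then (p k).2 else 0)) : ℤ) * (Complex.I * y i + t i)) := by
  have h : ∑ k, 2 * Real.pi * Complex.I * ((p k).2 : ℂ) *
      ((Complex.I * y (upperEnd Γ Ω k) + t (upperEnd Γ Ω k)) -
      (Complex.I * y (lowerEnd Γ Ω k) + t (lowerEnd Γ Ω k))) =
      ∑ i, 2 * Real.pi * Complex.I *
        (∑ k, ((if upperEnd Γ Ω k = i then (p k).2 else 0) -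
          (if lowerEnd Γ Ω k = i then (p k).2 else 0)) : ℤ) * (Complex.I * y i + t i) := by
    push_cast
    simp only [Finset.mul_sum, Finset.sum_mul]
    rw [Finset.sum_comm]
    refine Finset.sum_congr rfl fun k _ => ?_
    simp only [mul_sub, sub_mul, Finset.sum_sub_distrib, mul_ite, ite_mul, mul_zero, zero_mul,
      Finset.sum_ite_eq, Finset.mem_univ, if_true]
  rw [← Complex.exp_sum, ← h, Complex.exp_sum, ← Finset.prod_mul_distrib, integrandTerm]
  exact Finset.prod_congr rfl fun k _ => by ring

theorem integral_integrandTerm (p : Fin (3 * g - 3) → ℕ × ℤ) :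
    ∫ t in Set.Icc (0 : Fin (2 * g - 2) → ℝ) 1, integrandTerm Γ Ω y τ p t =
      (if ∀ i, exponentAt Γ Ω (fun k => (p k).2) i = 0 then
        ((∏ k, propagatorCoeff (p k).1 (p k).2 : ℕ) : ℂ) else 0) *
      ∏ k, nome (τ k) ^ (2 * (p k).1) := by
  simp only [integrandTerm_eq]
  rw [MeasureTheory.integral_const_mul, integral_cube_cexp]
  have h : ∀ i, (∑ k, ((if upperEnd Γ Ω k = i then (p k).2 else 0) -
      (if lowerEnd Γ Ω k = i then (p k).2 else 0)) = 0) ↔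
      exponentAt Γ Ω (fun k => (p k).2) i = 0 := by
    intro i
    -- The integrand has upper over lower end, `exponentAt` the inverse quotient with squares; the
    -- factor `-2` does not affect vanishing.
    have : exponentAt Γ Ω (fun k => (p k).2) i =
        -2 * ∑ k, ((if upperEnd Γ Ω k = i then (p k).2 else 0) -
        (if lowerEnd Γ Ω k = i then (p k).2 else 0)) := by
      rw [exponentAt, Finset.mul_sum]
      refine Finset.sum_congr rfl fun k _ => ?_
      split_ifs <;> ring
    rw [this]
    omega
  simp only [h]
  rw [Finset.prod_mul_distrib]
  split_ifs
  · push_cast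
    ring
  · ring

theorem hasSum_constantTermCoeff (a : Fin (3 * g - 3) → ℕ) :
    HasSum (fun m : Fin (3 * g - 3) → ℤ => if ∀ i, exponentAt Γ Ω m i = 0 then
      ((∏ k, propagatorCoeff (a k) (m k) : ℕ) : ℂ) else 0) (constantTermCoeff Γ Ω a : ℂ) := by
  have hfin := finite_constantTermContributions (Γ := Γ) (Ω := Ω) (a := a)
  rw [constantTermCoeff, finsum_mem_eq_finite_toFinset_sum _ hfin, Nat.cast_sum]
  have hs := hasSum_sum_of_ne_finset_zero (s := hfin.toFinset) (L := .unconditional _)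
    (f := fun m => if ∀ i, exponentAt Γ Ω m i = 0 then
        ((∏ k, propagatorCoeff (a k) (m k) : ℕ) : ℂ) else 0) (by
      intro m hm
      rw [Set.Finite.mem_toFinset] at hm
      rw [ite_eq_right_iff]
      intro h
      by_contra hne
      rw [Nat.cast_eq_zero, Finset.prod_eq_zero_iff] at hne
      push Not at hne
      exact hm ⟨fun k => hne k (Finset.mem_univ k), h⟩)
  convert! hs using 1
  refine Finset.sum_congr rfl fun m hm => ?_
  rw [Set.Finite.mem_toFinset] at hm
  rw [if_pos hm.2]

theorem hasSum_feynmanIntegral (hy : AdmissibleStart Ω τ y) :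
    HasSum (fun a : Fin (3 * g - 3) → ℕ => (constantTermCoeff Γ Ω a : ℂ) *
      ∏ k, nome (τ k) ^ (2 * a k)) (feynmanIntegral Γ y τ) := by
  by_cases hloop : HasLoop Γ
  · rw [feynmanIntegral, if_pos hloop]
    simp only [constantTermCoeff_eq_zero_of_hasLoop hloop, Nat.cast_zero, zero_mul]
    exact hasSum_zero
  rw [feynmanIntegral, if_neg hloop]
  have h0 := (hasSum_integrandTerm hloop hy 0).summable.norm
  have h : HasSum (fun p => ∫ t in Set.Icc (0 : Fin (2 * g - 2) → ℝ) 1, integrandTerm Γ Ω y τ p t)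
      (∫ t in Set.Icc (0 : Fin (2 * g - 2) → ℝ) 1, feynmanIntegrand Γ y τ t) := by
    refine MeasureTheory.hasSum_integral_of_dominated_convergence
      (fun p _ => ‖integrandTerm Γ Ω y τ p 0‖) (fun p => ?_) (fun p => ?_) ?_ ?_ ?_
    · exact (continuous_integrandTerm p).aestronglyMeasurable
    · exact .of_forall fun t => (norm_integrandTerm p t).le
    · exact .of_forall fun _ => h0
    · exact MeasureTheory.integrableOn_const isCompact_Icc.measure_lt_top.ne
    · exact .of_forall fun t => hasSum_integrandTerm hloop hy t
  -- Split the choice of monomials into multidegree and exponents, then sum over the exponents for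
  -- fixed multidegree.
  have h1 : HasSum (fun q : (Fin (3 * g - 3) → ℕ) × (Fin (3 * g - 3) → ℤ) =>
      ∫ t in Set.Icc (0 : Fin (2 * g - 2) → ℝ) 1,
        integrandTerm Γ Ω y τ (fun k => (q.1 k, q.2 k)) t)
      (∫ t in Set.Icc (0 : Fin (2 * g - 2) → ℝ) 1, feynmanIntegrand Γ y τ t) :=
    (Equiv.arrowProdEquivProdArrow _ (fun _ => ℕ) (fun _ => ℤ)).symm.hasSum_iff.2 h
  refine h1.prod_fiberwise fun a => ?_
  simp only [integral_integrandTerm]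
  exact (hasSum_constantTermCoeff a).mul_right _

end Integral

/-! ### The shape of tropical Hurwitz covers -/

namespace Multigraph

variable {V E : Type} [Fintype E]

theorem sum_valence [Fintype V] (G : Multigraph V E) : ∑ v, G.valence v = 2 * Fintype.card E := by
  classical
  have h := Finset.card_eq_sum_card_fiberwise (f := G.flagVertex) (s := Finset.univ)
    (t := Finset.univ) fun _ _ => Finset.mem_coe.2 (Finset.mem_univ _)
  rw [Finset.card_univ, Fintype.card_prod, Fintype.card_bool] at h
  rw [mul_comm, h]
  refine Finset.sum_congr rfl fun v _ => ?_
  rw [valence, flagsAt]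

/-- If no edge ends at `v`, the property of being `v` is constant along chains of edges, so `v` is
not joined to the ends of `e`. -/
theorem valence_ne_zero_of_connected {G : Multigraph V E} (h : G.Connected) (e : E) (v : V) :
    G.valence v ≠ 0 := by
  intro hv
  rw [valence, Finset.card_eq_zero] at hv
  have hv' : ∀ f, G.flagVertex f ≠ v := by
    intro f hf
    rw [← mem_flagsAt, hv] at hf
    simp at hf
  have key : ∀ u w, Relation.EqvGen (fun x y => ∃ e, G.end₁ e = x ∧ G.end₂ e = y) u w →
      (u = v ↔ w = v) := by
    intro u w huw
    induction huw with
    | rel x y hxy =>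
      obtain ⟨e, rfl, rfl⟩ := hxy
      exact iff_of_false (hv' (e, false)) (hv' (e, true))
    | refl x => exact Iff.rfl
    | symm x y _ ih => exact ih.symm
    | trans x y z _ _ ih1 ih2 => exact ih1.trans ih2
  exact hv' (e, false) ((key _ _ (h.2 v (G.end₁ e))).1 rfl)

end Multigraph

theorem TropicalEllipticCurve.vertex_ne_zero {n : ℕ} (T : TropicalEllipticCurve n) (j : Fin n) :
    T.vertex j ≠ 0 := by
  intro h
  rw [TropicalEllipticCurve.vertex, AddCircle.coe_eq_zero_iff] at h
  obtain ⟨k, hk⟩ := h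
  rw [zsmul_eq_mul] at hk
  have h1 := T.point_pos j
  have h2 := T.point_lt j
  have hL := T.circumference_pos
  have h3 : (0 : ℝ) < k := by nlinarith
  have h4 : (k : ℝ) < 1 := by nlinarith
  have h3' : 0 < k := by exact_mod_cast h3
  have h4' : k < 1 := by exact_mod_cast h4
  omega

theorem TropicalEllipticCurve.vertex_injective {n : ℕ} (T : TropicalEllipticCurve n) :
    Function.Injective T.vertex := by
  intro i j h
  rw [TropicalEllipticCurve.vertex, TropicalEllipticCurve.vertex, ← sub_eq_zero,
    ← AddCircle.coe_sub, AddCircle.coe_eq_zero_iff] at h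
  obtain ⟨k, hk⟩ := h
  rw [zsmul_eq_mul] at hk
  have h1 := LabeledCover.point_sub_lt T i j
  have h2 := LabeledCover.point_sub_lt T j i
  have hL := T.circumference_pos
  have h3 : (-1 : ℝ) < k := by nlinarith
  have h4 : (k : ℝ) < 1 := by nlinarith
  have h3' : -1 < k := by exact_mod_cast h3
  have h4' : k < 1 := by exact_mod_cast h4
  have h5 : k = 0 := by omega
  rw [h5] at hk
  apply T.point_strictMono.injective
  simp at hk
  linarith

namespace TropicalCover

variable {n : ℕ} {T : TropicalEllipticCurve n} {V E : Type} [Fintype V] [Fintype E]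

/-- Surjectivity provides an edge, so connectedness excludes isolated vertices; a single flag would
violate harmonicity. -/
theorem two_le_valence (π : TropicalCover T V E) (v : V) : 2 ≤ π.valence v := by
  obtain ⟨e, -⟩ := π.surjective 0
  have h0 := valence_ne_zero_of_connected π.connected e v
  have h1 : π.valence v ≠ 1 := by
    intro h1
    obtain ⟨f, hf⟩ := Finset.card_eq_one.1 h1
    have := π.sum_outSlope_eq_zero v
    rw [hf, Finset.sum_singleton, outSlope] at this
    have := π.slope_ne_zero f.1
    split_ifs at * <;> omega
  omega

theorem one_le_ramification (π : TropicalCover T V E) (v : V) : 1 ≤ π.ramification v := by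
  rw [ramification_eq]
  have := π.two_le_valence v
  have := π.canonical v
  omega

theorem sum_ramification (π : TropicalCover T V E) :
    ∑ v, π.ramification v = 2 * (π.totalGenus - 1) := by
  have h := π.sum_valence
  zify at h
  simp only [ramification_eq, Finset.sum_add_distrib, Finset.sum_sub_distrib, h]
  rw [TropicalCurve.totalGenus, ← Finset.mul_sum]
  simp
  ring

/-- The number of branch points determines the shape of a Hurwitz cover: there is exactly one vertex
over each vertex of the target, and all vertices are `3`-valent of genus zero. -/
theorem IsHurwitz.shape {π : TropicalCover T V E} (h : π.IsHurwitz)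
    (hn : 2 * (π.totalGenus - 1) = n) :
    (∃ e : V ≃ Fin n, ∀ v, π.pos v = T.vertex (e v)) ∧ ∀ v, π.valence v = 3 ∧ π.genus v = 0 := by
  choose b hb using h.strict
  have hbinj : Function.Injective b := by
    intro i j hij
    apply T.vertex_injective
    rw [← (hb i).1, ← (hb j).1, hij]
  have hsum := π.sum_ramification
  -- Now `n ≤ |V| ≤ ∑ ramification = n`, so every ramification is one and `b` is a bijection.
  have hcard : n ≤ Fintype.card V := by simpa using Fintype.card_le_of_injective b hbinj
  have hsum1 : (Fintype.card V : ℤ) ≤ ∑ v, π.ramification v := by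
    simpa using Finset.sum_le_sum fun v (_ : v ∈ Finset.univ) => π.one_le_ramification v
  have hcard' : Fintype.card V = n := by omega
  have hram : ∀ v, π.ramification v = 1 := by
    have h1 : ∑ v : V, (1 : ℤ) = ∑ v, π.ramification v := by
      simp
      omega
    have h2 := (Finset.sum_eq_sum_iff_of_le fun v _ => π.one_le_ramification v).1 h1
    exact fun v => (h2 v (Finset.mem_univ v)).symm
  have hbij : Function.Bijective b := by
    rw [Fintype.bijective_iff_injective_and_card]
    exact ⟨hbinj, by simp [hcard']⟩
  refine ⟨⟨(Equiv.ofBijective b hbij).symm, fun v => ?_⟩, fun v => ?_⟩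
  · have := (hb ((Equiv.ofBijective b hbij).symm v)).1
    rw [← this]
    congr 1
    exact ((Equiv.ofBijective b hbij).apply_symm_apply v).symm
  · have h1 := hram v
    rw [ramification_eq] at h1
    have := π.two_le_valence v
    omega

theorem degree_eq_sum_edgeDegree {π : TropicalCover T V E} (h : ∀ v, ∃ j, π.pos v = T.vertex j) :
    π.degree = ∑ e, π.edgeDegree e := by
  classical
  rw [degree, Finset.sum_eq_zero, zero_add]
  intro v hv
  obtain ⟨j, hj⟩ := h v
  rw [Finset.mem_filter, hj] at hv
  exact absurd hv.2 (T.vertex_ne_zero j)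

theorem isHurwitz_of_trivalent {π : TropicalCover T V E}
    (h3 : ∀ v, π.valence v = 3) (h0 : ∀ v, π.genus v = 0) (hpos : ∀ j, ∃ v, π.pos v = T.vertex j) :
    π.IsHurwitz := by
  have h : ∀ v, π.ramification v = 1 := fun v => by
    rw [ramification_eq, h3, h0]
    rfl
  refine ⟨fun v => by rw [h]; decide, fun j => ?_⟩
  obtain ⟨v, hv⟩ := hpos j
  exact ⟨v, hv, by rw [h]; decide⟩

/-! ### Transport of covers along isomorphisms -/

variable {V' E' V'' E'' : Type} [Fintype V'] [Fintype E'] [Fintype V''] [Fintype E'']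
  {π : TropicalCover T V E} {π' : TropicalCover T V' E'}
  {φ : (V ≃ V') × (E ≃ E')}

theorem IsIso.toMultigraph (h : π.IsIso π' φ) :
    π.toMultigraph.IsIso π'.toMultigraph φ := fun e =>
  (h.2.2.2 e).imp (fun h => ⟨h.1, h.2.1⟩) fun h => ⟨h.1, h.2.1⟩

theorem IsIso.edgeDegree_eq (h : π.IsIso π' φ) (e : E) :
    π'.edgeDegree (φ.2 e) = π.edgeDegree e := by
  rw [edgeDegree, edgeDegree, h.weight_eq]
  congr 1
  obtain ⟨h1, h2, h3, h4⟩ := h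
  rcases h4 e with ⟨ha, hb, hc⟩ | ⟨ha, hb, hc⟩
  · simp only [edgeMap, ha, hc, h1, h3]
  · have key : ∀ t, π'.edgeMap (φ.2 e) t = π.edgeMap e (π.length e - t) := by
      intro t
      simp only [edgeMap, ha, hc, h1]
      rw [← π.map_end₂, add_assoc, ← AddCircle.coe_add]
      congr 2
      push_cast
      ring
    rw [← Set.ncard_image_of_injective {t | t ∈ Set.Ioo 0 (π.length e) ∧ π.edgeMap e t = 0}
      (sub_right_injective (b := π.length e))]
    congr 1
    ext t
    simp only [Set.mem_ofPred_eq, Set.mem_image, key, h3, Set.mem_Ioo]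
    constructor
    · rintro ⟨⟨h5, h6⟩, h7⟩
      exact ⟨π.length e - t, ⟨⟨by linarith, by linarith⟩, h7⟩, by ring⟩
    · rintro ⟨u, ⟨⟨h5, h6⟩, h7⟩, rfl⟩
      refine ⟨⟨by linarith, by linarith⟩, ?_⟩
      rw [sub_sub_cancel]
      exact h7

theorem exists_isIso_of_isIso (π : TropicalCover T V E) (G : Multigraph V' E') (hG : G.Connected)
    (h3 : ∀ v, G.valence v = 3) (hφ : π.toMultigraph.IsIso G φ) :
    ∃ π' : TropicalCover T V' E', π'.toMultigraph = G ∧ π.IsIso π' φ := by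
  classical
  -- The slope changes sign where `φ` reverses the reference orientation. On a loop both
  -- alternatives may hold, and the slope is then kept.
  let s : E → ℤ := fun e => if G.end₁ (φ.2 e) = φ.1 (π.end₁ e) ∧ G.end₂ (φ.2 e) = φ.1 (π.end₂ e)
    then π.slope e else -π.slope e
  have hs : ∀ e, (G.end₁ (φ.2 e) = φ.1 (π.end₁ e) ∧ G.end₂ (φ.2 e) = φ.1 (π.end₂ e) ∧
      s e = π.slope e) ∨ (G.end₁ (φ.2 e) = φ.1 (π.end₂ e) ∧ G.end₂ (φ.2 e) = φ.1 (π.end₁ e) ∧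
      s e = -π.slope e) := by
    intro e
    by_cases h : G.end₁ (φ.2 e) = φ.1 (π.end₁ e) ∧ G.end₂ (φ.2 e) = φ.1 (π.end₂ e)
    · exact Or.inl ⟨h.1, h.2, if_pos h⟩
    · have := (hφ e).resolve_left h
      exact Or.inr ⟨this.1, this.2, if_neg h⟩
  have hs0 : ∀ e, s e ≠ 0 := by
    intro e
    have := π.slope_ne_zero e
    rcases hs e with h | h <;> rw [h.2.2] <;> omega
  refine ⟨{ toMultigraph := G
            length := fun e => π.length (φ.2.symm e)
            length_pos := fun e => π.length_pos _
            genus := fun v => π.genus (φ.1.symm v)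
            connected := hG
            canonical := fun v => Or.inr (by rw [h3]; decide)
            pos := fun v => π.pos (φ.1.symm v)
            slope := fun e => s (φ.2.symm e)
            slope_ne_zero := fun e => hs0 _
            map_end₂ := ?_
            surjective := ?_
            harmonic := ?_ }, rfl, ?_, ?_, ?_, ?_⟩
  · intro e
    obtain ⟨e, rfl⟩ := φ.2.surjective e
    have h := π.map_end₂ e
    rcases hs e with ⟨ha, hb, hc⟩ | ⟨ha, hb, hc⟩
    · simp only [ha, hb, Equiv.symm_apply_apply, hc]
      exact h
    · simp only [ha, hb, Equiv.symm_apply_apply, hc]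
      rw [← h, add_assoc, ← AddCircle.coe_add]
      simp
  · intro x
    obtain ⟨e, t, ht, hx⟩ := π.surjective x
    rcases hs e with ⟨ha, hb, hc⟩ | ⟨ha, hb, hc⟩
    · refine ⟨φ.2 e, t, by simpa using ht, ?_⟩
      simp only [ha, Equiv.symm_apply_apply, hc]
      exact hx
    · refine ⟨φ.2 e, π.length e - t, ?_, ?_⟩
      · simp only [Equiv.symm_apply_apply]
        exact ⟨by linarith [ht.2], by linarith [ht.1]⟩
      · simp only [ha, Equiv.symm_apply_apply, hc]
        have he : (π.slope e : ℝ) * π.length e + ((-π.slope e : ℤ) : ℝ) * (π.length e - t) =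
            π.slope e * t := by
          push_cast
          ring
        rw [← hx, ← π.map_end₂ e, add_assoc, ← AddCircle.coe_add, he]
  · intro v
    refine (harmonic_iff_sum_outSlope_eq_zero G (fun e => s (φ.2.symm e)) v).2 ?_
    obtain ⟨v, rfl⟩ := φ.1.surjective v
    rw [← π.sum_outSlope_eq_zero v, sum_flagsAt, sum_flagsAt]
    refine (Fintype.sum_equiv φ.2 _ _ fun e => ?_).symm
    rcases hs e with ⟨ha, hb, hc⟩ | ⟨ha, hb, hc⟩
    · simp [ha, hb, hc, outSlope]
    · simp [ha, hb, hc, outSlope, add_comm]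
  · simp
  · simp
  · simp
  · intro e
    simpa using hs e

/-- A cover without loops is determined by an isomorphism from another cover. -/
theorem IsIso.target_unique {π'' : TropicalCover T V' E'} (h : π.IsIso π' φ) (k : π.IsIso π'' φ)
    (hG : π'.toMultigraph = π''.toMultigraph) (hloop : ∀ e, π.end₁ e ≠ π.end₂ e) : π' = π'' := by
  obtain ⟨h1, h2, h3, h4⟩ := h
  obtain ⟨k1, k2, k3, k4⟩ := k
  refine ext_of_data hG ?_ ?_ ?_ ?_
  · funext e
    obtain ⟨e, rfl⟩ := φ.2.surjective e
    rw [h3, k3]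
  · funext v
    obtain ⟨v, rfl⟩ := φ.1.surjective v
    rw [h2, k2]
  · funext v
    obtain ⟨v, rfl⟩ := φ.1.surjective v
    rw [h1, k1]
  · funext e
    obtain ⟨e, rfl⟩ := φ.2.surjective e
    have hl := hloop e
    have h4 := h4 e
    have k4 := k4 e
    rw [hG] at h4
    rcases h4 with ⟨ha, hb, hc⟩ | ⟨ha, hb, hc⟩ <;> rcases k4 with ⟨ka, kb, kc⟩ | ⟨ka, kb, kc⟩
    · rw [hc, kc]
    -- An edge preserved by one isomorphism and reversed by the other would be a loop.
    · exact absurd (φ.1.injective (ha.symm.trans ka)) hl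
    · exact absurd (φ.1.injective (ka.symm.trans ha)) hl
    · rw [hc, kc]

/-- The isomorphisms between isomorphic covers form a torsor under the automorphism group. -/
theorem IsIso.card_eq_autCard (h : π.IsIso π' φ) :
    Nat.card {ψ : (V ≃ V') × (E ≃ E') // π.IsIso π' ψ} = π.autCard := by
  refine Nat.card_congr
    { toFun := fun p => ⟨_, p.2.trans h.symm⟩
      invFun := fun p => ⟨_, p.2.trans h⟩
      left_inv := fun p => ?_
      right_inv := fun p => ?_ }
  · apply Subtype.ext
    apply Prod.ext <;> ext x <;> simp
  · apply Subtype.ext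
    apply Prod.ext <;> ext x <;> simp

theorem autCard_ne_zero (π : TropicalCover T V E) : π.autCard ≠ 0 := by
  have : Nonempty {φ : Equiv.Perm V × Equiv.Perm E // π.IsIso π φ} :=
    ⟨⟨_, IsIso.refl π⟩⟩
  have : Finite (Equiv.Perm V × Equiv.Perm E) := inferInstance
  exact Nat.card_pos.ne'

end TropicalCover

/-! ### Counting covers over a reference graph -/

section Counting

variable {g : ℕ} {T : TropicalEllipticCurve (2 * g - 2)} {Γ : FeynmanGraph g} {d : ℕ}

/-- The tropical Hurwitz covers of degree `d` whose source is a metrization of `Γ`. -/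
def CoverOver (T : TropicalEllipticCurve (2 * g - 2)) (Γ : FeynmanGraph g) (d : ℕ) : Type :=
  {π : TropicalCover T (Fin (2 * g - 2)) (Fin (3 * g - 3)) //
    π.IsHurwitz ∧ π.toMultigraph = Γ.toMultigraph ∧ (∀ i, π.genus i = 0) ∧ π.degree = d}

instance (d : ℕ) : Finite {a : Fin (3 * g - 3) → ℕ // ∑ k, a k = d} := by
  refine Finite.of_injective (β := Fin (3 * g - 3) → Fin (d + 1)) (fun a k => ⟨a.1 k, ?_⟩) ?_
  · have := Finset.single_le_sum (f := a.1) (fun _ _ => Nat.zero_le _) (Finset.mem_univ k)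
    have := a.2
    omega
  · intro a b h
    apply Subtype.ext
    funext k
    have := congrFun h k
    simpa using this

/-! ### Covers with source a fixed graph and the action of its automorphisms -/

namespace CoverOver

theorem totalGenus_eq (hg : 2 ≤ g) (π : CoverOver T Γ d) : π.1.totalGenus = g := by
  rw [TropicalCurve.totalGenus]
  simp only [π.2.2.2.1, Fintype.card_fin]
  simp
  omega

theorem exists_order (hg : 2 ≤ g) (π : CoverOver T Γ d) :
    ∃ Ω : VertexOrder g, ∀ i, π.1.pos i = T.vertex (Ω i) := by
  refine (π.2.1.shape ?_).1
  rw [π.totalGenus_eq hg]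
  omega

/-- Labeled covers, forgetting the order and the multidegree. -/
def ofLabeled (p : Σ Ω : VertexOrder g, Σ a : {a : Fin (3 * g - 3) → ℕ // ∑ k, a k = d},
    LabeledCover T Γ Ω a.1) : CoverOver T Γ d :=
  ⟨p.2.2.1, p.2.2.2.1, p.2.2.2.2.1, p.2.2.2.2.2.1,
    (TropicalCover.degree_eq_sum_edgeDegree fun v => ⟨_, p.2.2.2.2.2.2.1 v⟩).trans
      ((Finset.sum_congr rfl fun k _ => p.2.2.2.2.2.2.2 k).trans p.2.1.2)⟩

/-- The order is read off from the positions of the vertices, which lie over distinct `p_j` by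
`IsHurwitz.shape`, and the multidegree from the edges. -/
theorem ofLabeled_bijective (hg : 2 ≤ g) :
    Function.Bijective (ofLabeled : _ → CoverOver T Γ d) := by
  constructor
  · rintro ⟨Ω, ⟨a, ha⟩, ⟨π, h1, h2, h3, h4, h5⟩⟩ ⟨Ω', ⟨a', ha'⟩, ⟨π', h1', h2', h3', h4', h5'⟩⟩ h
    have hπ : π = π' := congrArg Subtype.val h
    subst hπ
    have hΩ : Ω = Ω' := by
      ext i
      rw [T.vertex_injective ((h4 i).symm.trans (h4' i))]
    have haa : a = a' := by
      funext k
      exact (h5 k).symm.trans (h5' k)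
    subst hΩ haa
    rfl
  · intro π
    obtain ⟨Ω, hΩ⟩ := π.exists_order hg
    refine ⟨⟨Ω, ⟨π.1.edgeDegree, ?_⟩, ⟨π.1, π.2.1, π.2.2.1, π.2.2.2.1, hΩ, fun _ => rfl⟩⟩, rfl⟩
    rw [← TropicalCover.degree_eq_sum_edgeDegree fun v => ⟨_, hΩ v⟩]
    exact π.2.2.2.2

theorem finite (hg : 2 ≤ g) : Finite (CoverOver T Γ d) :=
  Finite.of_surjective _ (ofLabeled_bijective hg).2

theorem sum_weight [Fintype (CoverOver T Γ d)]
    [Fintype {a : Fin (3 * g - 3) → ℕ // ∑ k, a k = d}] (hg : 2 ≤ g) :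
    ∑ π : CoverOver T Γ d, ∏ k, π.1.weight k =
      ∑ Ω : VertexOrder g, ∑ a : {a : Fin (3 * g - 3) → ℕ // ∑ k, a k = d},
        labeledCount T Γ Ω a.1 := by
  have : ∀ (Ω : VertexOrder g) (a : Fin (3 * g - 3) → ℕ), Fintype (LabeledCover T Γ Ω a) :=
    fun _ _ => Fintype.ofFinite _
  rw [← Fintype.sum_bijective _ (ofLabeled_bijective hg)
    (fun p => ∏ k, p.2.2.1.weight k) _ fun p => rfl]
  rw [Fintype.sum_sigma]
  refine Finset.sum_congr rfl fun Ω _ => ?_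
  rw [Fintype.sum_sigma]
  refine Finset.sum_congr rfl fun a _ => ?_
  rw [labeledCount, finsum_eq_sum_of_fintype]

theorem end₁_ne_end₂ (π : CoverOver T Γ d) (k : Fin (3 * g - 3)) : π.1.end₁ k ≠ π.1.end₂ k := by
  intro h
  have h3 : π.1.valence (π.1.end₁ k) = 3 := by
    rw [π.2.2.1]
    exact Γ.trivalent _
  exact end₂_ne_of_valence_eq_three π.1.slope_ne_zero h3
    (π.1.sum_outSlope_eq_zero _) k rfl h.symm

theorem exists_isIso (hg : 2 ≤ g) {V E : Type} [Fintype V] [Fintype E] (π : TropicalCover T V E)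
    (hπ : π.IsHurwitz) (hgenus : π.totalGenus = g) (hd : π.degree = d)
    (φ : (V ≃ Fin (2 * g - 2)) × (E ≃ Fin (3 * g - 3)))
    (hφ : π.toMultigraph.IsIso Γ.toMultigraph φ) :
    ∃ π' : CoverOver T Γ d, π.IsIso π'.1 φ := by
  obtain ⟨⟨e, he⟩, h2⟩ := hπ.shape (by rw [hgenus]; omega)
  obtain ⟨π', h1, h⟩ := π.exists_isIso_of_isIso Γ.toMultigraph Γ.connected Γ.trivalent hφ
  have hgen : ∀ i, π'.genus i = 0 := by
    intro i
    obtain ⟨v, rfl⟩ := φ.1.surjective i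
    rw [h.2.1, (h2 v).2]
  have hpos : ∀ v, π'.pos v = T.vertex (e (φ.1.symm v)) := by
    intro v
    obtain ⟨v, rfl⟩ := φ.1.surjective v
    rw [h.1, he, Equiv.symm_apply_apply]
  refine ⟨⟨π', ?_, h1, hgen, ?_⟩, h⟩
  · refine TropicalCover.isHurwitz_of_trivalent ?_ hgen fun j => ⟨φ.1 (e.symm j), ?_⟩
    · rw [h1]
      exact Γ.trivalent
    · rw [hpos]
      simp
  · rw [TropicalCover.degree_eq_sum_edgeDegree fun v => ⟨_, hpos v⟩, ← hd,
      TropicalCover.degree_eq_sum_edgeDegree fun v => ⟨_, he v⟩]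
    exact (Fintype.sum_equiv φ.2 _ _ fun k => (h.edgeDegree_eq k).symm).symm

/-- The automorphisms of `Γ` act on the covers over `Γ`, and the orbits are the isomorphism
classes. -/
theorem autCard_eq_sum [Fintype (CoverOver T Γ d)] (hg : 2 ≤ g) (π₀ : CoverOver T Γ d) :
    Γ.autCard = ∑ π : CoverOver T Γ d,
      Nat.card {φ : Equiv.Perm (Fin (2 * g - 2)) × Equiv.Perm (Fin (3 * g - 3)) //
        π₀.1.IsIso π.1 φ} := by
  rw [← Nat.card_sigma, Multigraph.autCard]
  symm
  have hiso : ∀ (π : CoverOver T Γ d) (φ : Equiv.Perm (Fin (2 * g - 2)) × Equiv.Perm (Fin (3 * g - 3))),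
      π₀.1.IsIso π.1 φ → Γ.IsIso Γ.toMultigraph φ := by
    intro π φ h
    have := h.toMultigraph
    rwa [π₀.2.2.1, π.2.2.1] at this
  -- Every automorphism `φ` of `Γ` is an isomorphism from `π₀` to exactly one cover over `Γ`:
  -- transport gives existence, absence of loops uniqueness.
  refine Nat.card_eq_of_bijective
    (fun p => ⟨p.2.1, hiso p.1 p.2.1 p.2.2⟩ :
      (Σ π : CoverOver T Γ d, {φ : Equiv.Perm (Fin (2 * g - 2)) × Equiv.Perm (Fin (3 * g - 3)) //
        π₀.1.IsIso π.1 φ}) → {φ : Equiv.Perm (Fin (2 * g - 2)) × Equiv.Perm (Fin (3 * g - 3)) //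
        Γ.IsIso Γ.toMultigraph φ}) ⟨?_, ?_⟩
  · rintro ⟨π, φ, hφ⟩ ⟨π', φ', hφ'⟩ h
    have h1 : φ = φ' := congrArg Subtype.val h
    subst h1
    have h2 : π = π' := Subtype.ext
      (hφ.target_unique hφ' (π.2.2.1.trans π'.2.2.1.symm) π₀.end₁_ne_end₂)
    subst h2
    rfl
  · rintro ⟨φ, hφ⟩
    obtain ⟨π, hπ⟩ := exists_isIso (Γ := Γ) hg π₀.1 π₀.2.1 (π₀.totalGenus_eq hg) π₀.2.2.2.2 φ (by
      rw [π₀.2.2.1]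
      exact hφ)
    exact ⟨⟨π, φ, hπ⟩, rfl⟩

/-- A cover over `Γ`, forgetting the labels. -/
def toHurwitzClass (hg : 2 ≤ g) (π : CoverOver T Γ d) : HurwitzClass T g d :=
  Quotient.mk (hurwitzSetoid T g d) ⟨_, _, π.1, π.2.1, π.totalGenus_eq hg, π.2.2.2.2⟩

theorem toHurwitzClass_eq_iff (hg : 2 ≤ g) {Γ' : FeynmanGraph g} (π : CoverOver T Γ d)
    (π' : CoverOver T Γ' d) :
    π.toHurwitzClass hg = π'.toHurwitzClass hg ↔ ∃ φ, π.1.IsIso π'.1 φ :=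
  Quotient.eq (r := hurwitzSetoid T g d)

end CoverOver

/-! ### From covers over reference graphs to isomorphism classes -/

theorem exists_labeled_isIso (Γ : FeynmanGraph g) :
    ∃ (c : FeynmanClass g) (φ : _), Γ.IsIso c.labeled.toMultigraph φ := by
  have h := Quotient.exact (s := feynmanSetoid g)
    (Quotient.out_eq (s := feynmanSetoid g) (Quotient.mk (feynmanSetoid g) Γ))
  exact ⟨Quotient.mk (feynmanSetoid g) Γ, (feynmanSetoid g).symm h⟩

theorem FeynmanClass.labeled_inj {c c' : FeynmanClass g}
    (h : ∃ φ, c.labeled.IsIso c'.labeled.toMultigraph φ) : c = c' := by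
  rw [← Quotient.out_eq (s := feynmanSetoid g) c, ← Quotient.out_eq (s := feynmanSetoid g) c']
  exact Quotient.sound (s := feynmanSetoid g) h

/-- The map from the covers over the reference graphs to the isomorphism classes. -/
def hurwitzClassMap (T : TropicalEllipticCurve (2 * g - 2)) (d : ℕ) (hg : 2 ≤ g)
    (p : Σ c : FeynmanClass g, CoverOver T c.labeled d) : HurwitzClass T g d :=
  p.2.toHurwitzClass hg

theorem hurwitzClassMap_surjective (hg : 2 ≤ g) :
    Function.Surjective (hurwitzClassMap T d hg) := by
  intro x
  obtain ⟨⟨nV, nE, π, h, hgenus, hd⟩, rfl⟩ := Quotient.exists_rep (s := hurwitzSetoid T g d) x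
  obtain ⟨⟨e, he⟩, h2⟩ := h.shape (by rw [hgenus]; omega)
  -- The shape fixes the number of vertices; trivalence gives `3 nV = 2 nE`.
  have hV : nV = 2 * g - 2 := by simpa using Fintype.card_congr e
  have hE : nE = 3 * g - 3 := by
    have := π.sum_valence
    simp only [fun v => (h2 v).1] at this
    simp at this
    omega
  subst hV hE
  obtain ⟨c, φ, hφ⟩ := exists_labeled_isIso (⟨π.toMultigraph, fun v => (h2 v).1, π.connected⟩ :
    FeynmanGraph g)
  obtain ⟨π', hπ'⟩ := CoverOver.exists_isIso (Γ := c.labeled) hg π h hgenus hd φ hφ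
  refine ⟨⟨c, π'⟩, (Quotient.sound (s := hurwitzSetoid T g d) ?_).symm⟩
  exact ⟨φ, hπ'⟩

theorem finite_hurwitzClass (hg : 2 ≤ g) : Finite (HurwitzClass T g d) := by
  have : ∀ c : FeynmanClass g, Finite (CoverOver T c.labeled d) := fun c => CoverOver.finite hg
  exact Finite.of_surjective _ (hurwitzClassMap_surjective hg)

/-- The class of `π₀` has `|Aut Γ| / |Aut π₀|` representatives over its reference graph and none
over the others. All have the same weight product, so weighting each by `1 / |Aut Γ|` yields the
multiplicity of the class. -/
theorem tropicalHurwitzNumber_eq [Fintype (FeynmanClass g)]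
    [∀ Γ : FeynmanGraph g, Fintype (CoverOver T Γ d)] (hg : 2 ≤ g) :
    tropicalHurwitzNumber T g d = ∑ c : FeynmanClass g, (1 / (c.labeled.autCard : ℚ)) *
      ∑ π : CoverOver T c.labeled d, ((∏ k, π.1.weight k : ℕ) : ℚ) := by
  classical
  have : Fintype (HurwitzClass T g d) := @Fintype.ofFinite _ (finite_hurwitzClass hg)
  rw [tropicalHurwitzNumber, finsum_eq_sum_of_fintype]
  simp only [Finset.mul_sum]
  rw [← Fintype.sum_sigma' (fun (c : FeynmanClass g) (π : CoverOver T c.labeled d) =>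
      (1 / (c.labeled.autCard : ℚ)) * ((∏ k, π.1.weight k : ℕ) : ℚ)),
    ← Finset.sum_fiberwise (s := Finset.univ) (g := hurwitzClassMap T d hg)]
  refine Finset.sum_congr rfl fun x _ => ?_
  obtain ⟨⟨c₀, π₀⟩, rfl⟩ := hurwitzClassMap_surjective hg x
  have haut := CoverOver.autCard_eq_sum hg π₀
  have hfib : ∑ p : (Σ c : FeynmanClass g, CoverOver T c.labeled d) with
      hurwitzClassMap T d hg p = hurwitzClassMap T d hg ⟨c₀, π₀⟩,
      (1 / (p.1.labeled.autCard : ℚ)) * ((∏ k, p.2.1.weight k : ℕ) : ℚ) =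
      ∑ π : CoverOver T c₀.labeled d, (1 / (c₀.labeled.autCard : ℚ)) *
        (if ∃ φ, π₀.1.IsIso π.1 φ then ((∏ k, π₀.1.weight k : ℕ) : ℚ) else 0) := by
    rw [Finset.sum_filter, Fintype.sum_sigma, Fintype.sum_eq_single c₀]
    · refine Finset.sum_congr rfl fun π _ => ?_
      have hiff : hurwitzClassMap T d hg ⟨c₀, π⟩ = hurwitzClassMap T d hg ⟨c₀, π₀⟩ ↔
          ∃ φ, π₀.1.IsIso π.1 φ := by
        rw [eq_comm]
        exact CoverOver.toHurwitzClass_eq_iff hg π₀ π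
      simp only [hiff]
      split_ifs with h
      · obtain ⟨φ, hφ⟩ := h
        rw [← Fintype.prod_equiv φ.2 _ _ fun e => (hφ.weight_eq e).symm]
      · rw [mul_zero]
    · intro c hc
      refine Finset.sum_eq_zero fun π _ => if_neg fun h => hc ?_
      obtain ⟨φ, hφ⟩ := (CoverOver.toHurwitzClass_eq_iff hg π π₀).1 h
      have := hφ.toMultigraph
      rw [π.2.2.1, π₀.2.2.1] at this
      exact FeynmanClass.labeled_inj ⟨φ, this⟩
  rw [hfib]
  have hcard : ∀ π : CoverOver T c₀.labeled d,
      Nat.card {φ : Equiv.Perm (Fin (2 * g - 2)) × Equiv.Perm (Fin (3 * g - 3)) //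
        π₀.1.IsIso π.1 φ} = if ∃ φ, π₀.1.IsIso π.1 φ then π₀.1.autCard else 0 := by
    intro π
    split_ifs with h
    · obtain ⟨φ, hφ⟩ := h
      exact hφ.card_eq_autCard
    · have : IsEmpty {φ : Equiv.Perm (Fin (2 * g - 2)) × Equiv.Perm (Fin (3 * g - 3)) //
        π₀.1.IsIso π.1 φ} := ⟨fun φ => h ⟨φ.1, φ.2⟩⟩
      exact Nat.card_of_isEmpty
  simp only [hcard] at haut
  rw [← Finset.sum_filter, Finset.sum_const, smul_eq_mul] at haut
  rw [← Finset.mul_sum, ← Finset.sum_filter, Finset.sum_const, nsmul_eq_mul, haut]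
  have h1 : (π₀.1.autCard : ℚ) ≠ 0 := by exact_mod_cast π₀.1.autCard_ne_zero
  have h2 : ((Finset.univ.filter fun π : CoverOver T c₀.labeled d =>
      ∃ φ, π₀.1.IsIso π.1 φ).card : ℚ) ≠ 0 := by
    rw [Nat.cast_ne_zero]
    exact Finset.card_ne_zero.2 ⟨π₀, by
      simp only [Finset.mem_filter, Finset.mem_univ, true_and]
      exact ⟨_, TropicalCover.IsIso.refl _⟩⟩
  change π₀.1.mult = _
  rw [TropicalCover.mult]
  push_cast
  field_simp

end Counting

/-! ### Tropical mirror symmetry -/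

section Mirror

variable {g : ℕ} {T : TropicalEllipticCurve (2 * g - 2)}

/-- The `q^{2d}`-coefficients of a Feynman integral with all variables `q_k` equal. -/
theorem hasSum_feynmanIntegral_diagonal
    [∀ d, Fintype {a : Fin (3 * g - 3) → ℕ // ∑ k, a k = d}] {Γ : FeynmanGraph g}
    {Ω : VertexOrder g} {τ : ℍ} {y : Fin (2 * g - 2) → ℝ} (hy : AdmissibleStart Ω (fun _ => τ) y) :
    HasSum (fun d : ℕ => ((∑ a : {a : Fin (3 * g - 3) → ℕ // ∑ k, a k = d},
        labeledCount T Γ Ω a.1 : ℕ) : ℂ) * nome τ ^ (2 * d))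
      (feynmanIntegral Γ y fun _ => τ) := by
  have h := hasSum_feynmanIntegral (Γ := Γ) hy
  rw [← (Equiv.sigmaFiberEquiv fun a : Fin (3 * g - 3) → ℕ => ∑ k, a k).hasSum_iff] at h
  refine h.sigma fun d => ?_
  have h2 := hasSum_fintype fun a : {a : Fin (3 * g - 3) → ℕ // ∑ k, a k = d} =>
    (constantTermCoeff Γ Ω a.1 : ℂ) * ∏ k, nome τ ^ (2 * a.1 k)
  convert! h2 using 1
  rw [Nat.cast_sum, Finset.sum_mul]
  refine Finset.sum_congr rfl fun a _ => ?_
  rw [Finset.prod_pow_eq_pow_sum, ← Finset.mul_sum, a.2, labeledCount_eq_constantTermCoeff]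

theorem hasSum_tropicalHurwitzNumber (hg : 2 ≤ g) (T : TropicalEllipticCurve (2 * g - 2)) (τ : ℍ)
    (y : VertexOrder g → Fin (2 * g - 2) → ℝ) (hy : ∀ Ω, AdmissibleStart Ω (fun _ => τ) (y Ω)) :
    HasSum (fun d : ℕ => (tropicalHurwitzNumber T g (d + 1) : ℂ) * nome τ ^ (2 * (d + 1)))
      (∑ᶠ c : FeynmanClass g, (1 / (c.labeled.autCard : ℂ)) *
        ∑ Ω : VertexOrder g, feynmanIntegral c.labeled (y Ω) (fun _ => τ)) := by
  have : Fintype (FeynmanClass g) := Fintype.ofFinite _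
  have : ∀ d, Fintype {a : Fin (3 * g - 3) → ℕ // ∑ k, a k = d} := fun d => Fintype.ofFinite _
  have : ∀ (d : ℕ) (Γ : FeynmanGraph g), Fintype (CoverOver T Γ d) :=
    fun d Γ => @Fintype.ofFinite _ (CoverOver.finite hg)
  rw [finsum_eq_sum_of_fintype]
  have h1 : HasSum (fun d : ℕ => ∑ c : FeynmanClass g, (1 / (c.labeled.autCard : ℂ)) *
      ∑ Ω : VertexOrder g, ((∑ a : {a : Fin (3 * g - 3) → ℕ // ∑ k, a k = d},
        labeledCount T c.labeled Ω a.1 : ℕ) : ℂ) * nome τ ^ (2 * d))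
      (∑ c : FeynmanClass g, (1 / (c.labeled.autCard : ℂ)) *
        ∑ Ω : VertexOrder g, feynmanIntegral c.labeled (y Ω) (fun _ => τ)) :=
    hasSum_sum fun c _ => (hasSum_sum fun Ω _ => hasSum_feynmanIntegral_diagonal (hy Ω)).mul_left _
  -- The integrals also have a term at `d = 0`; it vanishes by `constantTermCoeff_zero`, so the sum
  -- may start at `d = 1`.
  have h2 := (hasSum_nat_add_iff' 1).2 h1
  have h0 : ∑ c : FeynmanClass g, (1 / (c.labeled.autCard : ℂ)) *
      ∑ Ω : VertexOrder g, ((∑ a : {a : Fin (3 * g - 3) → ℕ // ∑ k, a k = 0},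
        labeledCount T c.labeled Ω a.1 : ℕ) : ℂ) * nome τ ^ (2 * 0) = 0 := by
    refine Finset.sum_eq_zero fun c _ => ?_
    rw [Finset.sum_eq_zero, mul_zero]
    intro Ω _
    rw [Finset.sum_eq_zero, Nat.cast_zero, zero_mul]
    intro a _
    rw [labeledCount_eq_constantTermCoeff, constantTermCoeff_zero hg a.2]
  rw [Finset.sum_range_one, h0, sub_zero] at h2
  convert! h2 using 2 with d
  rw [tropicalHurwitzNumber_eq hg]
  push_cast
  rw [Finset.sum_mul]
  refine Finset.sum_congr rfl fun c _ => ?_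
  rw [mul_assoc, ← Finset.sum_mul]
  congr 2
  have h3 := CoverOver.sum_weight (T := T) (Γ := c.labeled) (d := d + 1) hg
  exact_mod_cast h3

end Mirror

end TropicalMirror

end

theorem mainTheorem3 (g : ℕ) (hg : 2 ≤ g)
    (T : TropicalMirror.TropicalEllipticCurve (2 * g - 2)) :
    (∀ (τ : UpperHalfPlane) (z : ℂ), 0 < z.im → z.im < τ.im →
      HasSum (fun p : ℕ × ℤ => (TropicalMirror.propagatorCoeff p.1 p.2 : ℂ) *
          Complex.exp (Complex.I * Real.pi * z) ^ (2 * p.2) * TropicalMirror.nome τ ^ (2 * p.1))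
        (TropicalMirror.propagator z τ)) ∧
    (∀ (Γ : TropicalMirror.FeynmanGraph g) (Ω : TropicalMirror.VertexOrder g),
      (∀ a : Fin (3 * g - 3) → ℕ,
        Finite (TropicalMirror.LabeledCover T Γ Ω a) ∧
        (TropicalMirror.constantTermContributions Γ Ω a).Finite ∧
        TropicalMirror.labeledCount T Γ Ω a = TropicalMirror.constantTermCoeff Γ Ω a) ∧
      (∀ (τ : Fin (3 * g - 3) → UpperHalfPlane) (y : Fin (2 * g - 2) → ℝ),
        TropicalMirror.AdmissibleStart Ω τ y →
        (¬ TropicalMirror.HasLoop Γ → MeasureTheory.IntegrableOn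
          (TropicalMirror.feynmanIntegrand Γ y τ) (Set.Icc 0 1)) ∧
        HasSum (fun a : Fin (3 * g - 3) → ℕ => (TropicalMirror.labeledCount T Γ Ω a : ℂ) *
            ∏ k, TropicalMirror.nome (τ k) ^ (2 * a k))
          (TropicalMirror.feynmanIntegral Γ y τ))) ∧
    (∀ d : ℕ, Finite (TropicalMirror.HurwitzClass T g d)) ∧
    (∀ (τ : UpperHalfPlane) (y : TropicalMirror.VertexOrder g → Fin (2 * g - 2) → ℝ),
      (∀ Ω, TropicalMirror.AdmissibleStart Ω (fun _ => τ) (y Ω)) →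
      HasSum (fun d : ℕ => (TropicalMirror.tropicalHurwitzNumber T g (d + 1) : ℂ) *
          TropicalMirror.nome τ ^ (2 * (d + 1)))
        (∑ᶠ c : TropicalMirror.FeynmanClass g, (1 / (c.labeled.autCard : ℂ)) *
          ∑ Ω : TropicalMirror.VertexOrder g,
            TropicalMirror.feynmanIntegral c.labeled (y Ω) (fun _ => τ))) := by
  refine ⟨fun τ z hz hzτ => TropicalMirror.hasSum_propagator τ hz hzτ, fun Γ Ω => ⟨fun a =>
    ⟨inferInstance, TropicalMirror.finite_constantTermContributions,
      TropicalMirror.labeledCount_eq_constantTermCoeff⟩, fun τ y hy =>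
    ⟨fun hloop => TropicalMirror.integrableOn_feynmanIntegrand hloop hy, ?_⟩⟩,
    fun d => TropicalMirror.finite_hurwitzClass hg,
    fun τ y hy => TropicalMirror.hasSum_tropicalHurwitzNumber hg T τ y hy⟩
  simp only [TropicalMirror.labeledCount_eq_constantTermCoeff]
  exact TropicalMirror.hasSum_feynmanIntegral hy
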